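/- Write $B_r\subset\mathbb R^3$ for the open ball of radius $r$ centred at the origin and $|\cdot|$ for Lebesgue measure on $\mathbb R^3$. Let $R>0$, $M>0$, $\eta\in(0,1)$, and let $$f_\eta(s)=\begin{cases}\eta\,(s-|B_1|), & 0\le s\le |B_1|,\\ \frac1\eta\,(s-|B_1|), & s\ge |B_1|.\end{cases}$$ For $q\in[0,1)$ and $u\in H^1_0(B_R)$ (extended by $0$ to $\mathbb R^3$) set $$\mathcal E_{q,M,\eta}(u)=\int_{B_R}|\nabla u|^2\,dx+\frac q2\int_{B_R}\int_{B_R}\frac{u(x)u(y)}{|x-y|}\,dx\,dy+M\left|\int_{B_R}u^2\,dx-1\right|+f_\eta\big(|\{u\neq0\}|\big).$$ Then: (i) for every $q\in[0,1)$ the functional $\mathcal E_{q,M,\eta}$ has a minimizer in $H^1_0(B_R)$; (ii) there is a constant $C$, depending only on $\eta$, $R$ and $M$ (and not on $q$ or on the minimizer), such that for every $q\in[0,1)$ and every minimizer $u$ of $\mathcal E_{q,M,\eta}$ in $H^1_0(B_R)$ the set $\{u\neq 0\}$ has finite perimeter and $P(\{u\neq0\})\le C$, where for a Lebesgue measurable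 set $A\subset\mathbb R^3$ $$P(A)=\sup\left\{\int_A \operatorname{div}T\,dx \,:\, T\in C^1_c(\mathbb R^3;\mathbb R^3),\ |T|\le 1\right\}.$$ -/

import Mathlib

open Set Filter Topology MeasureTheory
open scoped ContDiff ENNReal

namespace CoulombDrop

noncomputable section

/-- The ambient space `ℝ³` with its Euclidean norm and Lebesgue measure. -/
abbrev E3 : Type := EuclideanSpace ℝ (Fin 3)

/-- The open ball `B_r` of radius `r` centred at the origin. -/
abbrev B (r : ℝ) : Set E3 := Metric.ball (0 : E3) r

/-- `φ` is a test function in `C_c^∞(Ω)`. -/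
def IsTestFunction (Ω : Set E3) (φ : E3 → ℝ) : Prop :=
  ContDiff ℝ ∞ φ ∧ HasCompactSupport φ ∧ tsupport φ ⊆ Ω

/-- `G` is the weak (distributional) gradient of `u` on `ℝ³`. -/
def HasWeakGradient (u : E3 → ℝ) (G : E3 → E3) : Prop :=
  ∀ φ : E3 → ℝ, IsTestFunction univ φ → ∀ i : Fin 3,
    ∫ x, u x * fderiv ℝ φ x (EuclideanSpace.single i 1) = - ∫ x, G x i * φ x

/-- `u ∈ H¹(ℝ³)`: both `u` and its weak gradient are square integrable. -/
def MemH1 (u : E3 → ℝ) : Prop :=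
  MemLp u 2 volume ∧ ∃ G : E3 → E3, MemLp G 2 volume ∧ HasWeakGradient u G

open Classical in
/-- The weak gradient of `u ∈ H¹(ℝ³)` (unique up to a null set); the value `0` for other `u` is
never used. -/
def weakGrad (u : E3 → ℝ) : E3 → E3 :=
  if h : MemH1 u then h.2.choose else 0

/-- `H¹₀(Ω)` for an open set `Ω`: the functions `u ∈ H¹(ℝ³)` that are limits in `H¹(ℝ³)` of a
sequence in `C_c^∞(Ω)`. As usual, functions that agree almost everywhere are not distinguished:
a function belongs to this set together with all its representatives. -/
def H10 (Ω : Set E3) : Set (E3 → ℝ) :=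
  {u | MemH1 u ∧ ∃ φ : ℕ → E3 → ℝ, (∀ n, IsTestFunction Ω (φ n)) ∧
    Tendsto (fun n => eLpNorm (fun x => φ n x - u x) 2 volume) atTop (𝓝 0) ∧
    Tendsto (fun n => eLpNorm (fun x => gradient (φ n) x - weakGrad u x) 2 volume)
      atTop (𝓝 0)}

/-- The Coulomb energy `D(φ, ψ) = ∫_Ω ∫_Ω φ(x) ψ(y) / |x - y| dx dy`. -/
def coulomb (Ω : Set E3) (φ ψ : E3 → ℝ) : ℝ :=
  ∫ x in Ω, ∫ y in Ω, φ x * ψ y / ‖x - y‖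

/-- The piecewise linear volume penalization `f_η`. -/
def fEta (η s : ℝ) : ℝ :=
  if s ≤ volume.real (B 1) then η * (s - volume.real (B 1))
  else (1 / η) * (s - volume.real (B 1))

/-- The functional `𝓔_{q,M,η}` on `H¹₀(B_R)`. -/
def energy (R q M η : ℝ) (u : E3 → ℝ) : ℝ :=
  (∫ x in B R, ‖weakGrad u x‖ ^ 2) + q / 2 * coulomb (B R) u u
    + M * |(∫ x in B R, u x ^ 2) - 1| + fEta η (volume.real {x | u x ≠ 0})

/-- `u` minimizes `𝓔_{q,M,η}` over `H¹₀(B_R)`. -/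
def IsMinimizer (R q M η : ℝ) (u : E3 → ℝ) : Prop :=
  u ∈ H10 (B R) ∧ ∀ v ∈ H10 (B R), energy R q M η u ≤ energy R q M η v

/-- The divergence of a vector field on `ℝ³`. -/
def divergence (T : E3 → E3) (x : E3) : ℝ :=
  ∑ i : Fin 3, fderiv ℝ T x (EuclideanSpace.single i 1) i

/-- The (distributional) perimeter in `ℝ³` of a Lebesgue measurable set `A`:
`P(A) = sup {∫_A div T : T ∈ C_c^1(ℝ³; ℝ³), |T| ≤ 1}`, with value `∞` if `A` does not have
finite perimeter. -/
def perimeter (A : Set E3) : ℝ≥0∞ :=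
  ⨆ (T : E3 → E3) (_ : ContDiff ℝ 1 T ∧ HasCompactSupport T ∧ ∀ x, ‖T x‖ ≤ 1),
    ENNReal.ofReal (∫ x in A, divergence T x)

end

end CoulombDrop

/-!
A function `u ∈ H¹₀(Ω)` is represented by the point `(u, ∇u)` of the Hilbert space
`L²(ℝ³; ℝ) × L²(ℝ³; ℝ³)`; in this picture `H¹₀(Ω)` is the closure `sobolevGraph Ω` of the graphs of
test functions, and integration by parts against a `C¹_c` field is a closed linear condition.

Existence is the direct method. The Coulomb energy is nonnegative (`coulomb_self_nonneg`), because
`1/r` is a superposition of the Gaussians `exp(-s²r²)`, each of which is a positive multiple of the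
convolution of a Gaussian with itself; so the energy is coercive. A bounded sequence in
`sobolevGraph (B R)` has a subsequence that converges weakly, with strong `L²` convergence of the
functions (`exists_subseq_sobolevGraph`): averaging a test function over balls of radius `δ` moves
it by at most `δ‖∇φ‖₂`, and turns weak convergence into pointwise bounded convergence. The
Dirichlet energy is weakly lower semicontinuous, the Coulomb and the mass term are continuous in
`L²`, and the volume of `{u ≠ 0}` is lower semicontinuous by Fatou's lemma.

For the perimeter bound, a minimizer `u` is compared with `ε F(u/ε)`, where `F` is a smooth
nondecreasing contraction that vanishes on `[-1, 1]` and differs from the identity by a bounded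
amount. This removes the Dirichlet energy and the volume of `{0 < |u| ≤ ε}`, while the Coulomb and
the mass term change by `O(ε)`; as `f_η` has slope at least `η`, minimality gives
`∫_{0 < |u| ≤ ε} |∇u|² + η |{0 < |u| ≤ ε}| ≤ K ε` (`exists_lowSet_bound`). For a cutoff `h` that is
`0` near the origin and `1` off `[-1, 1]`, the total variation of `h(u/ε)` is then at most
`(c/ε) ∫_{0 < |u| ≤ ε} |∇u| ≤ C`, and `h(u/ε)` tends to the indicator of `{u ≠ 0}` as `ε → 0`. No
coarea formula is needed.
-/

namespace CoulombDrop

noncomputable section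

/-! ### Test functions and their graphs in `L² × L²` -/

/-- The Hilbert space `L²(ℝ³; ℝ) × L²(ℝ³; ℝ³)` in which a Sobolev function `u` is represented by
the pair `(u, ∇u)`. -/
abbrev GraphSpace : Type :=
  WithLp 2 (Lp ℝ 2 (volume : Measure E3) × Lp E3 2 (volume : Measure E3))

lemma graphSpace_inner (x y : GraphSpace) :
    inner ℝ x y = (∫ z, x.fst z * y.fst z) + ∫ z, inner ℝ (x.snd z) (y.snd z) := by
  rw [WithLp.prod_inner_apply, L2.inner_def, L2.inner_def]
  congr 1
  refine integral_congr_ae (Eventually.of_forall fun z => ?_)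
  simp [mul_comm]

lemma graphSpace_norm_sq (x : GraphSpace) : ‖x‖ ^ 2 = ‖x.fst‖ ^ 2 + ‖x.snd‖ ^ 2 :=
  WithLp.prod_norm_sq_eq_of_L2 x

lemma integral_norm_sq_eq {F : Type*} [NormedAddCommGroup F] [InnerProductSpace ℝ F]
    (f : Lp F 2 (volume : Measure E3)) : ∫ z, ‖f z‖ ^ 2 = ‖f‖ ^ 2 := by
  rw [← real_inner_self_eq_norm_sq, L2.inner_def]
  simp only [real_inner_self_eq_norm_sq]

lemma continuous_gradient {φ : E3 → ℝ} (h : ContDiff ℝ 1 φ) : Continuous (gradient φ) :=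
  (InnerProductSpace.toDual ℝ E3).symm.continuous.comp (h.continuous_fderiv one_ne_zero)

lemma hasCompactSupport_gradient {φ : E3 → ℝ} (h : HasCompactSupport φ) :
    HasCompactSupport (gradient φ) :=
  (h.fderiv ℝ).comp_left (g := (InnerProductSpace.toDual ℝ E3).symm) (map_zero _)

lemma gradient_eq_zero_off {φ : E3 → ℝ} {x : E3} (h : x ∉ tsupport φ) : gradient φ x = 0 := by
  have : fderiv ℝ φ x = 0 := by
    by_contra h0
    exact h (support_fderiv_subset ℝ h0)
  simp [gradient, this]

namespace IsTestFunction

variable {Ω : Set E3} {φ ψ : E3 → ℝ}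

lemma contDiff (h : IsTestFunction Ω φ) : ContDiff ℝ 1 φ := h.1.of_le (by simp)

lemma differentiable (h : IsTestFunction Ω φ) : Differentiable ℝ φ :=
  h.contDiff.differentiable one_ne_zero

lemma continuous (h : IsTestFunction Ω φ) : Continuous φ := h.1.continuous

lemma memLp (h : IsTestFunction Ω φ) : MemLp φ 2 volume :=
  h.continuous.memLp_of_hasCompactSupport h.2.1

lemma memLp_gradient (h : IsTestFunction Ω φ) : MemLp (gradient φ) 2 volume :=
  (continuous_gradient h.contDiff).memLp_of_hasCompactSupport (hasCompactSupport_gradient h.2.1)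

lemma zero : IsTestFunction Ω (0 : E3 → ℝ) :=
  ⟨contDiff_const, HasCompactSupport.zero, by simp [tsupport]⟩

lemma add (h : IsTestFunction Ω φ) (h' : IsTestFunction Ω ψ) : IsTestFunction Ω (φ + ψ) :=
  ⟨h.1.add h'.1, h.2.1.add h'.2.1, (tsupport_add _ _).trans (union_subset h.2.2 h'.2.2)⟩

lemma smul (c : ℝ) (h : IsTestFunction Ω φ) : IsTestFunction Ω (c • φ) :=
  ⟨contDiff_const.smul h.1, h.2.1.smul_left (f := fun _ => c),
    (tsupport_smul_subset_right (fun _ => c) φ).trans h.2.2⟩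

lemma gradient_add (h : IsTestFunction Ω φ) (h' : IsTestFunction Ω ψ) :
    gradient (φ + ψ) = gradient φ + gradient ψ := by
  ext1 x
  simp [gradient, fderiv_add (h.differentiable x) (h'.differentiable x)]

lemma gradient_smul (c : ℝ) (h : IsTestFunction Ω φ) :
    gradient (c • φ) = c • gradient φ := by
  ext1 x
  simp [gradient, fderiv_const_smul (h.differentiable x) c]

/-- The point of the graph space represented by a test function and its gradient. -/
def graph (h : IsTestFunction Ω φ) : GraphSpace :=
  WithLp.toLp 2 (h.memLp.toLp φ, h.memLp_gradient.toLp (gradient φ))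

lemma graph_fst (h : IsTestFunction Ω φ) : h.graph.fst =ᵐ[volume] φ := h.memLp.coeFn_toLp

lemma graph_snd (h : IsTestFunction Ω φ) : h.graph.snd =ᵐ[volume] gradient φ :=
  h.memLp_gradient.coeFn_toLp

/-- Smooth functions of a test function that fix the origin are test functions. -/
lemma comp {F : ℝ → ℝ} (hF : ContDiff ℝ ∞ F) (h0 : F 0 = 0) (h : IsTestFunction Ω φ) :
    IsTestFunction Ω (F ∘ φ) := by
  refine ⟨hF.comp h.1, h.2.1.comp_left h0, ?_⟩
  refine (closure_mono ?_).trans h.2.2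
  intro x hx hx'
  simp [hx', h0] at hx

lemma gradient_comp {F : ℝ → ℝ} (hF : ContDiff ℝ ∞ F) (h : IsTestFunction Ω φ) (x : E3) :
    gradient (F ∘ φ) x = deriv F (φ x) • gradient φ x := by
  have hd : DifferentiableAt ℝ F (φ x) := (hF.differentiable (by simp)) _
  rw [gradient, (hd.hasDerivAt.comp_hasFDerivAt x (h.differentiable x).hasFDerivAt).fderiv,
    map_smulₛₗ]
  simp [gradient]

end IsTestFunction

/-- The graphs `(φ, ∇φ)` of the test functions `φ ∈ C_c^∞(Ω)`. -/
def testGraph (Ω : Set E3) : Submodule ℝ GraphSpace where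
  carrier := {x | ∃ φ, IsTestFunction Ω φ ∧ x.fst =ᵐ[volume] φ ∧ x.snd =ᵐ[volume] gradient φ}
  zero_mem' := ⟨0, IsTestFunction.zero, Lp.coeFn_zero _ _ _, by
    have : gradient (0 : E3 → ℝ) = 0 := by ext1 x; simp [gradient]
    rw [this]
    exact Lp.coeFn_zero _ _ _⟩
  add_mem' := by
    rintro x y ⟨φ, h, h1, h2⟩ ⟨ψ, h', h1', h2'⟩
    refine ⟨φ + ψ, h.add h', (Lp.coeFn_add _ _).trans (h1.add h1'), ?_⟩
    rw [h.gradient_add h']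
    exact (Lp.coeFn_add _ _).trans (h2.add h2')
  smul_mem' := by
    rintro c x ⟨φ, h, h1, h2⟩
    refine ⟨c • φ, h.smul c, (Lp.coeFn_smul _ _).trans (h1.const_smul c), ?_⟩
    rw [h.gradient_smul c]
    exact (Lp.coeFn_smul _ _).trans (h2.const_smul c)

lemma IsTestFunction.graph_mem {Ω : Set E3} {φ : E3 → ℝ} (h : IsTestFunction Ω φ) :
    h.graph ∈ testGraph Ω := ⟨φ, h, h.graph_fst, h.graph_snd⟩

/-- `H¹₀(Ω)` as a closed subspace of the graph space: the closure of the graphs of the test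
functions. -/
def sobolevGraph (Ω : Set E3) : Submodule ℝ GraphSpace := (testGraph Ω).topologicalClosure

lemma isClosed_sobolevGraph (Ω : Set E3) : IsClosed (sobolevGraph Ω : Set GraphSpace) :=
  (testGraph Ω).isClosed_topologicalClosure

/-! ### Integration by parts and uniqueness of the weak gradient -/

lemma fderiv_coord {T : E3 → E3} (hT : Differentiable ℝ T) (x v : E3) (i : Fin 3) :
    fderiv ℝ (fun y => T y i) x v = fderiv ℝ T x v i := by
  have h := ((EuclideanSpace.proj (𝕜 := ℝ) i).hasFDerivAt.comp x (hT x).hasFDerivAt).fderiv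
  exact congrArg (fun A => A v) h

lemma continuous_divergence {T : E3 → E3} (hT : ContDiff ℝ 1 T) : Continuous (divergence T) := by
  refine continuous_finsetSum _ fun i _ => ?_
  have := (hT.continuous_fderiv one_ne_zero).clm_apply
    (continuous_const (y := EuclideanSpace.single i (1 : ℝ)))
  exact (EuclideanSpace.proj (𝕜 := ℝ) i).continuous.comp this

lemma hasCompactSupport_divergence {T : E3 → E3} (hT : HasCompactSupport T) :
    HasCompactSupport (divergence T) :=
  (hT.fderiv ℝ).comp_left
    (g := fun A : E3 →L[ℝ] E3 => ∑ i : Fin 3, A (EuclideanSpace.single i 1) i) (by simp)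

lemma IsTestFunction.integral_mul_divergence {Ω : Set E3} {φ : E3 → ℝ} (h : IsTestFunction Ω φ)
    {T : E3 → E3} (hT : ContDiff ℝ 1 T) :
    ∫ x, φ x * divergence T x = -∫ x, inner ℝ (gradient φ x) (T x) := by
  have hTd := hT.differentiable one_ne_zero
  have hc : ∀ i, ContDiff ℝ 1 fun y => T y i := fun i =>
    (EuclideanSpace.proj (𝕜 := ℝ) i).contDiff.comp hT
  have key : ∀ i : Fin 3, ∫ x, φ x * fderiv ℝ (fun y => T y i) x (EuclideanSpace.single i 1)
      = -∫ x, fderiv ℝ φ x (EuclideanSpace.single i 1) * T x i := by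
    intro i
    have hcd : Continuous fun x => fderiv ℝ (fun y => T y i) x (EuclideanSpace.single i (1 : ℝ)) :=
      ((hc i).continuous_fderiv one_ne_zero).clm_apply continuous_const
    have hcd' : Continuous fun x => fderiv ℝ φ x (EuclideanSpace.single i (1 : ℝ)) :=
      (h.contDiff.continuous_fderiv one_ne_zero).clm_apply continuous_const
    refine integral_mul_fderiv_eq_neg_fderiv_mul_of_integrable ?_ ?_ ?_
      (fun x _ => h.differentiable x) (fun x _ => (hc i).differentiable one_ne_zero x)
    · refine (hcd'.mul (hc i).continuous).integrable_of_hasCompactSupport ?_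
      exact (h.2.1.fderiv_apply ℝ _).mul_right
    · exact (h.continuous.mul hcd).integrable_of_hasCompactSupport h.2.1.mul_right
    · exact (h.continuous.mul (hc i).continuous).integrable_of_hasCompactSupport h.2.1.mul_right
  have e1 : ∀ x, φ x * divergence T x =
      ∑ i : Fin 3, φ x * fderiv ℝ (fun y => T y i) x (EuclideanSpace.single i 1) := by
    intro x
    simp only [divergence, Finset.mul_sum, fderiv_coord hTd]
  have e2 : ∀ x, inner ℝ (gradient φ x) (T x) =
      ∑ i : Fin 3, fderiv ℝ φ x (EuclideanSpace.single i 1) * T x i := by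
    intro x
    rw [inner_gradient_left]
    have : T x = ∑ i : Fin 3, (T x i) • (EuclideanSpace.single i (1 : ℝ)) := by
      ext j
      fin_cases j <;> simp [Fin.sum_univ_three]
    conv_lhs => rw [this]
    simp [mul_comm]
  simp_rw [e1, e2]
  rw [integral_finsetSum, integral_finsetSum, Finset.sum_congr rfl fun i _ => key i,
    Finset.sum_neg_distrib]
  · intro i _
    have hcd' : Continuous fun x => fderiv ℝ φ x (EuclideanSpace.single i (1 : ℝ)) :=
      (h.contDiff.continuous_fderiv one_ne_zero).clm_apply continuous_const
    exact (hcd'.mul (hc i).continuous).integrable_of_hasCompactSupport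
      (h.2.1.fderiv_apply ℝ _).mul_right
  · intro i _
    have hcd : Continuous fun x => fderiv ℝ (fun y => T y i) x (EuclideanSpace.single i (1 : ℝ)) :=
      ((hc i).continuous_fderiv one_ne_zero).clm_apply continuous_const
    exact (h.continuous.mul hcd).integrable_of_hasCompactSupport h.2.1.mul_right

/-- Integration by parts in `H¹₀(Ω)` against a `C¹_c` vector field: for a fixed field both sides
are continuous in the graph norm. -/
lemma integral_fst_mul_divergence {Ω : Set E3} {x : GraphSpace} (hx : x ∈ sobolevGraph Ω)
    {T : E3 → E3} (hT : ContDiff ℝ 1 T) (hTc : HasCompactSupport T) :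
    ∫ z, x.fst z * divergence T z = -∫ z, inner ℝ (x.snd z) (T z) := by
  have hd : MemLp (divergence T) 2 (volume : Measure E3) :=
    (continuous_divergence hT).memLp_of_hasCompactSupport (hasCompactSupport_divergence hTc)
  have hT2 : MemLp T 2 (volume : Measure E3) := hT.continuous.memLp_of_hasCompactSupport hTc
  -- the identity says that the graph is orthogonal to `(div T, T)`
  let w : GraphSpace := WithLp.toLp 2 (hd.toLp _, hT2.toLp _)
  have hw : ∀ y : GraphSpace, inner ℝ y w =
      (∫ z, y.fst z * divergence T z) + ∫ z, inner ℝ (y.snd z) (T z) := by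
    intro y
    rw [graphSpace_inner]
    congr 1
    · refine integral_congr_ae ?_
      filter_upwards [hd.coeFn_toLp] with z hz
      change _ * (hd.toLp _) z = _
      rw [hz]
    · refine integral_congr_ae ?_
      filter_upwards [hT2.coeFn_toLp] with z hz
      change inner ℝ _ ((hT2.toLp _) z) = _
      rw [hz]
  have hle : sobolevGraph Ω ≤ (Submodule.span ℝ {w})ᗮ := by
    refine Submodule.topologicalClosure_minimal _ ?_ (Submodule.isClosed_orthogonal _)
    rintro y ⟨φ, h, h1, h2⟩
    rw [Submodule.mem_orthogonal_singleton_iff_inner_left, hw]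
    have e1 : ∫ z, y.fst z * divergence T z = ∫ z, φ z * divergence T z :=
      integral_congr_ae (by filter_upwards [h1] with z hz; rw [hz])
    have e2 : ∫ z, inner ℝ (y.snd z) (T z) = ∫ z, inner ℝ (gradient φ z) (T z) :=
      integral_congr_ae (by filter_upwards [h2] with z hz; rw [hz])
    rw [e1, e2, h.integral_mul_divergence hT]
    ring
  have := Submodule.mem_orthogonal_singleton_iff_inner_left.1 (hle hx)
  rw [hw] at this
  linarith

lemma hasWeakGradient_of_mem {Ω : Set E3} {x : GraphSpace} (hx : x ∈ sobolevGraph Ω) :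
    HasWeakGradient x.fst x.snd := by
  intro φ h i
  let T : E3 → E3 := fun y => φ y • EuclideanSpace.single i (1 : ℝ)
  have hT : ContDiff ℝ 1 T := h.contDiff.smul contDiff_const
  have hTc : HasCompactSupport T := h.2.1.smul_right
  have := integral_fst_mul_divergence hx hT hTc
  have e : ∀ z, divergence T z = fderiv ℝ φ z (EuclideanSpace.single i 1) := by
    intro z
    have : fderiv ℝ T z = (fderiv ℝ φ z).smulRight (EuclideanSpace.single i (1 : ℝ)) :=
      ((h.differentiable z).hasFDerivAt.smul_const _).fderiv
    rw [divergence, this]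
    rw [Finset.sum_eq_single i] <;> simp +contextual
  simp_rw [e] at this
  rw [this]
  congr 1
  refine integral_congr_ae (Eventually.of_forall fun z => ?_)
  simp [T, inner_smul_right, EuclideanSpace.inner_single_right, mul_comm]

/-- The weak gradient is unique up to a null set. -/
lemma HasWeakGradient.ae_eq {u : E3 → ℝ} {G G' : E3 → E3} (hG : MemLp G 2 volume)
    (hG' : MemLp G' 2 volume) (h : HasWeakGradient u G) (h' : HasWeakGradient u G') :
    G =ᵐ[volume] G' := by
  have hc : ∀ {H : E3 → E3}, MemLp H 2 volume → ∀ i, MemLp (fun x => H x i) 2 volume :=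
    fun hH i => (EuclideanSpace.proj (𝕜 := ℝ) i).comp_memLp' hH
  have key : ∀ i : Fin 3, ∀ᵐ x, G x i - G' x i = 0 := by
    intro i
    have hi := hc hG i
    have hi' := hc hG' i
    refine ae_eq_zero_of_integral_contDiff_smul_eq_zero
      ((hi.sub hi').locallyIntegrable (by norm_num)) ?_
    intro φ h1 h2
    have ht : IsTestFunction univ φ := ⟨h1, h2, subset_univ _⟩
    have e := h φ ht i
    rw [h' φ ht i] at e
    have i1 : Integrable fun x => G x i * φ x := hi.integrable_mul ht.memLp
    have i2 : Integrable fun x => G' x i * φ x := hi'.integrable_mul ht.memLp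
    have : ∀ x, φ x • (G x i - G' x i) = G x i * φ x - G' x i * φ x := by
      intro x; simp; ring
    simp only [this]
    rw [integral_sub i1 i2]
    linarith
  filter_upwards [ae_all_iff.2 key] with x hx
  ext i
  linarith [hx i]

lemma HasWeakGradient.congr {u v : E3 → ℝ} {G : E3 → E3} (h : HasWeakGradient u G)
    (huv : u =ᵐ[volume] v) : HasWeakGradient v G := by
  intro φ hφ i
  rw [← h φ hφ i]
  exact integral_congr_ae (by filter_upwards [huv] with x hx; rw [hx])

/-! ### `H¹₀` as a closed subspace -/

lemma memH1_of_mem {Ω : Set E3} {x : GraphSpace} (hx : x ∈ sobolevGraph Ω) {u : E3 → ℝ}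
    (hu : u =ᵐ[volume] x.fst) : MemH1 u :=
  ⟨(memLp_congr_ae hu).2 (Lp.memLp _), x.snd, Lp.memLp _, (hasWeakGradient_of_mem hx).congr hu.symm⟩

lemma MemH1.memLp_weakGrad {u : E3 → ℝ} (h : MemH1 u) : MemLp (weakGrad u) 2 volume := by
  rw [weakGrad, dif_pos h]; exact h.2.choose_spec.1

lemma MemH1.hasWeakGradient_weakGrad {u : E3 → ℝ} (h : MemH1 u) :
    HasWeakGradient u (weakGrad u) := by
  rw [weakGrad, dif_pos h]; exact h.2.choose_spec.2

lemma weakGrad_ae_eq {Ω : Set E3} {x : GraphSpace} (hx : x ∈ sobolevGraph Ω) {u : E3 → ℝ}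
    (hu : u =ᵐ[volume] x.fst) : weakGrad u =ᵐ[volume] x.snd := by
  have h := memH1_of_mem hx hu
  exact h.hasWeakGradient_weakGrad.ae_eq h.memLp_weakGrad (Lp.memLp _)
    ((hasWeakGradient_of_mem hx).congr hu.symm)

/-- Convergence in `L²` expressed through arbitrary representatives. -/
lemma tendsto_eLpNorm_sub_iff {F : Type*} [NormedAddCommGroup F] {f : ℕ → E3 → F} {g : E3 → F}
    {p : ℕ → Lp F 2 (volume : Measure E3)} {q : Lp F 2 (volume : Measure E3)}
    (hf : ∀ n, p n =ᵐ[volume] f n) (hg : q =ᵐ[volume] g) :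
    Tendsto (fun n => eLpNorm (fun x => f n x - g x) 2 volume) atTop (𝓝 0) ↔
      Tendsto p atTop (𝓝 q) := by
  rw [Lp.tendsto_Lp_iff_tendsto_eLpNorm']
  refine tendsto_congr fun n => eLpNorm_congr_ae ?_
  filter_upwards [hf n, hg] with x h1 h2
  simp [h1, h2]

lemma graphSpace_tendsto_iff {p : ℕ → GraphSpace} {q : GraphSpace} :
    Tendsto p atTop (𝓝 q) ↔ Tendsto (fun n => (p n).fst) atTop (𝓝 q.fst) ∧
      Tendsto (fun n => (p n).snd) atTop (𝓝 q.snd) := by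
  constructor
  · intro h
    exact ⟨((WithLp.continuous_fst 2 _ _).tendsto q).comp h,
      ((WithLp.continuous_snd 2 _ _).tendsto q).comp h⟩
  · rintro ⟨h1, h2⟩
    have := ((WithLp.prod_continuous_toLp 2 (Lp ℝ 2 (volume : Measure E3))
      (Lp E3 2 (volume : Measure E3))).tendsto (q.fst, q.snd)).comp (h1.prodMk_nhds h2)
    exact this

/-- The members of `H¹₀(Ω)` are exactly the representatives of the points of `sobolevGraph Ω`. -/
lemma mem_H10_iff {Ω : Set E3} {u : E3 → ℝ} :
    u ∈ H10 Ω ↔ ∃ x ∈ sobolevGraph Ω, u =ᵐ[volume] x.fst := by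
  constructor
  · rintro ⟨h, φ, hφ, h1, h2⟩
    let x : GraphSpace := WithLp.toLp 2 (h.1.toLp u, h.memLp_weakGrad.toLp _)
    refine ⟨x, ?_, h.1.coeFn_toLp.symm⟩
    refine mem_closure_of_tendsto (f := fun n => (hφ n).graph) (b := atTop) ?_
      (Eventually.of_forall fun n => (hφ n).graph_mem)
    exact graphSpace_tendsto_iff.2
      ⟨(tendsto_eLpNorm_sub_iff (fun n => (hφ n).graph_fst) h.1.coeFn_toLp).1 h1,
      (tendsto_eLpNorm_sub_iff (fun n => (hφ n).graph_snd) h.memLp_weakGrad.coeFn_toLp).1 h2⟩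
  · rintro ⟨x, hx, hu⟩
    obtain ⟨y, hy, hyx⟩ := mem_closure_iff_seq_limit.1 hx
    choose φ hφ h1 h2 using hy
    obtain ⟨t1, t2⟩ := graphSpace_tendsto_iff.1 hyx
    exact ⟨memH1_of_mem hx hu, φ, hφ, (tendsto_eLpNorm_sub_iff h1 hu.symm).2 t1,
      (tendsto_eLpNorm_sub_iff h2 (weakGrad_ae_eq hx hu).symm).2 t2⟩

/-- A point of `sobolevGraph Ω` is the limit of graphs of test functions that also converge to it
almost everywhere. -/
lemma exists_seq_testFunction {Ω : Set E3} {x : GraphSpace} (hx : x ∈ sobolevGraph Ω) :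
    ∃ (φ : ℕ → E3 → ℝ) (h : ∀ n, IsTestFunction Ω (φ n)),
      Tendsto (fun n => (h n).graph) atTop (𝓝 x) ∧
      ∀ᵐ z, Tendsto (fun n => φ n z) atTop (𝓝 (x.fst z)) := by
  obtain ⟨y, hy, hyx⟩ := mem_closure_iff_seq_limit.1 hx
  choose φ hφ h1 h2 using hy
  have hyg : ∀ n, y n = (hφ n).graph := by
    intro n
    have e1 : (y n).fst = (hφ n).graph.fst := Lp.ext ((h1 n).trans (hφ n).graph_fst.symm)
    have e2 : (y n).snd = (hφ n).graph.snd := Lp.ext ((h2 n).trans (hφ n).graph_snd.symm)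
    calc y n = WithLp.toLp 2 ((y n).fst, (y n).snd) := rfl
      _ = _ := by rw [e1, e2]; rfl
  obtain ⟨ns, hns, hae⟩ :=
    (tendstoInMeasure_of_tendsto_Lp (graphSpace_tendsto_iff.1 hyx).1).exists_seq_tendsto_ae
  refine ⟨fun n => φ (ns n), fun n => hφ _, ?_, ?_⟩
  · exact (hyx.comp hns.tendsto_atTop).congr fun n => hyg _
  · filter_upwards [hae, ae_all_iff.2 h1] with z hz hz1
    refine hz.congr fun n => ?_
    rw [hz1]

/-- Members of `H¹₀(Ω)` and their gradients vanish almost everywhere off `Ω`. -/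
lemma ae_eq_zero_off {Ω : Set E3} {x : GraphSpace}
    (hx : x ∈ sobolevGraph Ω) : ∀ᵐ z, z ∉ Ω → x.fst z = 0 ∧ x.snd z = 0 := by
  obtain ⟨φ, h, hlim, hae⟩ := exists_seq_testFunction hx
  obtain ⟨ns, -, hae2⟩ :=
    (tendstoInMeasure_of_tendsto_Lp (graphSpace_tendsto_iff.1 hlim).2).exists_seq_tendsto_ae
  filter_upwards [hae, hae2, ae_all_iff.2 fun n => (h n).graph_snd] with z hz hz2 hg hzΩ
  have hz' : ∀ n, z ∉ tsupport (φ n) := fun n hn => hzΩ ((h n).2.2 hn)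
  constructor
  · refine tendsto_nhds_unique hz ?_
    simp [fun n => image_eq_zero_of_notMem_tsupport (hz' n)]
  · refine tendsto_nhds_unique hz2 ?_
    simp [hg, fun n => gradient_eq_zero_off (hz' n)]

/-! ### The chain rule in `H¹₀` -/

lemma eLpNorm_two_sq {F : Type*} [NormedAddCommGroup F] {α : Type*} [MeasurableSpace α]
    (μ : Measure α) (f : α → F) : eLpNorm f 2 μ ^ 2 = ∫⁻ x, ‖f x‖ₑ ^ 2 ∂μ := by
  have h := eLpNorm_nnreal_pow_eq_lintegral (f := f) (μ := μ) (p := 2) (by norm_num)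
  simpa using h

/-- Dominated convergence in `L²`. -/
lemma tendsto_eLpNorm_zero_of_dominated {F : Type*} [NormedAddCommGroup F] {f : ℕ → E3 → F}
    {g : E3 → ℝ} (hf : ∀ n, AEStronglyMeasurable (f n) volume) (hg : MemLp g 2 volume)
    (hfg : ∀ n, ∀ᵐ x, ‖f n x‖ ≤ g x) (hlim : ∀ᵐ x, Tendsto (fun n => f n x) atTop (𝓝 0)) :
    Tendsto (fun n => eLpNorm (f n) 2 volume) atTop (𝓝 0) := by
  have key : Tendsto (fun n => ∫⁻ x, ‖f n x‖ₑ ^ 2) atTop (𝓝 (∫⁻ _ : E3, 0)) := by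
    refine tendsto_lintegral_of_dominated_convergence' (fun x => ‖g x‖ₑ ^ 2)
      (fun n => (hf n).enorm.pow_const 2) (fun n => ?_) ?_ ?_
    · filter_upwards [hfg n] with x hx
      gcongr
      rw [enorm_le_iff_norm_le]
      exact hx.trans (le_abs_self _)
    · rw [← eLpNorm_two_sq]
      exact ENNReal.pow_ne_top hg.eLpNorm_ne_top
    · filter_upwards [hlim] with x hx
      have := (ENNReal.continuous_pow 2).tendsto _ |>.comp (hx.enorm)
      simpa [Function.comp_def] using this
  simp only [← eLpNorm_two_sq, lintegral_zero] at key
  have h2 := (ENNReal.continuous_rpow_const (y := 1 / 2)).tendsto _ |>.comp key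
  have e : ∀ a : ℝ≥0∞, (a ^ 2) ^ (1 / 2 : ℝ) = a := by
    intro a
    rw [← ENNReal.rpow_natCast, ← ENNReal.rpow_mul]
    simp
  simpa [Function.comp_def, e, -one_div] using h2

lemma norm_sub_le_of_deriv_le {F : ℝ → ℝ} (hF : ContDiff ℝ ∞ F) {L : ℝ}
    (hL : ∀ s, |deriv F s| ≤ L) (a b : ℝ) : ‖F a - F b‖ ≤ L * ‖a - b‖ :=
  Convex.norm_image_sub_le_of_norm_deriv_le (s := univ)
    (fun x _ => (hF.differentiable (by simp)) x) (fun x _ => hL x) convex_univ (mem_univ b)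
    (mem_univ a)

/-- The chain rule: a smooth function with bounded derivative that fixes the origin acts on
`H¹₀(Ω)`. -/
theorem exists_comp_mem {Ω : Set E3} {x : GraphSpace} (hx : x ∈ sobolevGraph Ω) {F : ℝ → ℝ}
    (hF : ContDiff ℝ ∞ F) (h0 : F 0 = 0) {L : ℝ} (hL : ∀ s, |deriv F s| ≤ L) :
    ∃ y ∈ sobolevGraph Ω, y.fst =ᵐ[volume] (fun z => F (x.fst z)) ∧
      y.snd =ᵐ[volume] fun z => deriv F (x.fst z) • x.snd z := by
  have hL0 : 0 ≤ L := (abs_nonneg _).trans (hL 0)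
  have hF' : Continuous (deriv F) := hF.continuous_deriv (by simp)
  obtain ⟨φ, h, hlim, hae⟩ := exists_seq_testFunction hx
  obtain ⟨t1, t2⟩ := graphSpace_tendsto_iff.1 hlim
  have m1 : MemLp (fun z => F (x.fst z)) 2 (volume : Measure E3) := by
    refine (Lp.memLp x.fst).of_le_mul (c := L)
      (hF.continuous.comp_aestronglyMeasurable (Lp.aestronglyMeasurable _))
      (Eventually.of_forall fun z => ?_)
    simpa [h0] using norm_sub_le_of_deriv_le hF hL (x.fst z) 0
  have hm : AEStronglyMeasurable (fun z => deriv F (x.fst z)) (volume : Measure E3) :=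
    hF'.comp_aestronglyMeasurable (Lp.aestronglyMeasurable _)
  have m2 : MemLp (fun z => deriv F (x.fst z) • x.snd z) 2 (volume : Measure E3) := by
    refine (Lp.memLp x.snd).of_le_mul (c := L) (hm.smul (Lp.aestronglyMeasurable _))
      (Eventually.of_forall fun z => ?_)
    rw [norm_smul]
    exact mul_le_mul_of_nonneg_right (hL _) (norm_nonneg _)
  refine ⟨WithLp.toLp 2 (m1.toLp _, m2.toLp _), ?_, m1.coeFn_toLp, m2.coeFn_toLp⟩
  refine mem_closure_of_tendsto (f := fun n => ((h n).comp hF h0).graph) (b := atTop) ?_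
    (Eventually.of_forall fun n => ((h n).comp hF h0).graph_mem)
  have s1 := (tendsto_eLpNorm_sub_iff (fun n => (h n).graph_fst) (ae_eq_refl (x.fst : E3 → ℝ))).2 t1
  have s2 := (tendsto_eLpNorm_sub_iff (fun n => (h n).graph_snd)
    (ae_eq_refl (x.snd : E3 → E3))).2 t2
  have hmul : ∀ {a : ℕ → ℝ≥0∞}, Tendsto a atTop (𝓝 0) →
      Tendsto (fun n => ENNReal.ofReal L * a n) atTop (𝓝 0) := by
    intro a ha
    simpa using ENNReal.Tendsto.const_mul (a := ENNReal.ofReal L) ha (Or.inr ENNReal.ofReal_ne_top)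
  refine graphSpace_tendsto_iff.2 ⟨(tendsto_eLpNorm_sub_iff
    (fun n => ((h n).comp hF h0).graph_fst) m1.coeFn_toLp).1 ?_, (tendsto_eLpNorm_sub_iff
    (fun n => ((h n).comp hF h0).graph_snd) m2.coeFn_toLp).1 ?_⟩
  · refine tendsto_of_tendsto_of_tendsto_of_le_of_le tendsto_const_nhds (hmul s1)
      (fun _ => zero_le) fun n => ?_
    exact eLpNorm_le_mul_eLpNorm_of_ae_le_mul (Eventually.of_forall fun z =>
      norm_sub_le_of_deriv_le hF hL (φ n z) (x.fst z)) 2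
  · have s3 : Tendsto (fun n => eLpNorm
        (fun z => (deriv F (φ n z) - deriv F (x.fst z)) • x.snd z) 2 volume) atTop (𝓝 0) := by
      refine tendsto_eLpNorm_zero_of_dominated (g := fun z => (2 * L) * ‖x.snd z‖) (fun n => ?_)
        ((Lp.memLp x.snd).norm.const_mul _) (fun n => Eventually.of_forall fun z => ?_) ?_
      · exact ((hF'.comp (h n).continuous).aestronglyMeasurable.sub hm).smul
          (Lp.aestronglyMeasurable _)
      · rw [norm_smul]
        refine mul_le_mul_of_nonneg_right ?_ (norm_nonneg _)
        have a := norm_sub_le (deriv F (φ n z)) (deriv F (x.fst z))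
        have b := hL (φ n z)
        have c := hL (x.fst z)
        simp only [Real.norm_eq_abs] at a ⊢
        linarith
      · filter_upwards [hae] with z hz
        have a := ((hF'.tendsto _).comp hz).sub_const (deriv F (x.fst z))
        simpa using a.smul_const (x.snd z)
    have s4 := (hmul s2).add s3
    rw [add_zero] at s4
    refine tendsto_of_tendsto_of_tendsto_of_le_of_le tendsto_const_nhds s4
      (fun _ => zero_le) fun n => ?_
    have e : (fun z => gradient (F ∘ φ n) z - deriv F (x.fst z) • x.snd z) =
        (fun z => deriv F (φ n z) • (gradient (φ n) z - x.snd z)) +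
          fun z => (deriv F (φ n z) - deriv F (x.fst z)) • x.snd z := by
      ext1 z
      simp only [Pi.add_apply, (h n).gradient_comp hF, smul_sub, sub_smul]
      abel
    have hm' : AEStronglyMeasurable (fun z => deriv F (φ n z)) (volume : Measure E3) :=
      (hF'.comp (h n).continuous).aestronglyMeasurable
    rw [e]
    refine (eLpNorm_add_le (hm'.smul ((continuous_gradient (h n).contDiff).aestronglyMeasurable.sub
      (Lp.aestronglyMeasurable _))) ((hm'.sub hm).smul (Lp.aestronglyMeasurable _))
      one_le_two).trans ?_
    refine add_le_add ?_ le_rfl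
    refine eLpNorm_le_mul_eLpNorm_of_ae_le_mul (Eventually.of_forall fun z => ?_) 2
    change ‖deriv F (φ n z) • (gradient (φ n) z - x.snd z)‖ ≤ _
    rw [norm_smul]
    exact mul_le_mul_of_nonneg_right (hL _) (norm_nonneg _)

/-! ### Weak sequential compactness -/

/-- Bounded sequences in a separable Hilbert space have weakly convergent subsequences. -/
lemma exists_subseq_weak {H : Type*} [NormedAddCommGroup H] [InnerProductSpace ℝ H]
    [CompleteSpace H] [TopologicalSpace.SeparableSpace H] {x : ℕ → H} {C : ℝ}
    (hx : ∀ n, ‖x n‖ ≤ C) : ∃ (y : H) (ns : ℕ → ℕ), StrictMono ns ∧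
      ∀ w, Tendsto (fun n => inner ℝ (x (ns n)) w) atTop (𝓝 (inner ℝ y w)) := by
  obtain ⟨a, -, ns, hns, ha⟩ := WeakDual.isSeqCompact_closedBall ℝ H 0 C
    (x := fun n => StrongDual.toWeakDual (InnerProductSpace.toDual ℝ H (x n)))
    (fun n => by simpa using hx n)
  refine ⟨(InnerProductSpace.toDual ℝ H).symm (WeakDual.toStrongDual a), ns, hns, fun w => ?_⟩
  have := ((WeakDual.eval_continuous w).tendsto a).comp ha
  rw [InnerProductSpace.toDual_symm_apply]
  simpa [Function.comp_def] using this

/-- A closed subspace is its own double orthogonal complement, hence weakly closed. -/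
lemma mem_submodule_of_weak_tendsto {H : Type*} [NormedAddCommGroup H] [InnerProductSpace ℝ H]
    [CompleteSpace H] {K : Submodule ℝ H} (hK : IsClosed (K : Set H)) {x : ℕ → H} {y : H}
    (hx : ∀ n, x n ∈ K) (h : ∀ w, Tendsto (fun n => inner ℝ (x n) w) atTop (𝓝 (inner ℝ y w))) :
    y ∈ K := by
  have : y ∈ Kᗮᗮ := by
    rw [Submodule.mem_orthogonal']
    intro w hw
    refine tendsto_nhds_unique (h w) ?_
    simp [fun n => Submodule.inner_right_of_mem_orthogonal (hx n) hw]
  rwa [Submodule.orthogonal_orthogonal_eq_closure, hK.submodule_topologicalClosure_eq] at this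

instance separableSpace_graphSpace : TopologicalSpace.SeparableSpace GraphSpace := by
  have : Fact ((2 : ℝ≥0∞) ≠ ⊤) := ⟨ENNReal.ofNat_ne_top⟩
  have : SecondCountableTopology (Lp ℝ 2 (volume : Measure E3)) := inferInstance
  have : SecondCountableTopology (Lp E3 2 (volume : Measure E3)) := inferInstance
  exact (WithLp.homeomorphProd 2 (Lp ℝ 2 (volume : Measure E3))
    (Lp E3 2 (volume : Measure E3))).symm.surjective.denseRange.separableSpace
      (Homeomorph.continuous _)

/-! ### Rellich compactness -/

/-- Jensen's inequality for the square. -/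
lemma enorm_integral_sq_le {α : Type*} [MeasurableSpace α] {μ : Measure α} [IsProbabilityMeasure μ]
    {f : α → ℝ} (hf : AEStronglyMeasurable f μ) : ‖∫ t, f t ∂μ‖ₑ ^ 2 ≤ ∫⁻ t, ‖f t‖ₑ ^ 2 ∂μ := by
  rw [← eLpNorm_two_sq]
  gcongr
  calc ‖∫ t, f t ∂μ‖ₑ ≤ ∫⁻ t, ‖f t‖ₑ ∂μ := enorm_integral_le_lintegral_enorm _
    _ = eLpNorm f 1 μ := eLpNorm_one_eq_lintegral_enorm.symm
    _ ≤ eLpNorm f 2 μ := eLpNorm_le_eLpNorm_of_exponent_le one_le_two hf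

/-- A translation by `v` moves a test function in `L²` by at most `‖v‖ ‖∇φ‖₂`: integrate the
gradient along the segment. -/
lemma IsTestFunction.lintegral_translate_sub_sq_le {Ω : Set E3} {φ : E3 → ℝ}
    (h : IsTestFunction Ω φ) (v : E3) :
    ∫⁻ x, ‖φ (x + v) - φ x‖ₑ ^ 2 ≤ ‖v‖ₑ ^ 2 * ∫⁻ x, ‖gradient φ x‖ₑ ^ 2 := by
  let μ : Measure ℝ := volume.restrict (Ioc 0 1)
  have : IsProbabilityMeasure μ := ⟨by simp [μ]⟩
  have hc : Continuous (gradient φ) := continuous_gradient h.contDiff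
  have hpt : ∀ x, ‖φ (x + v) - φ x‖ₑ ^ 2 ≤ ∫⁻ t, ‖v‖ₑ ^ 2 * ‖gradient φ (x + t • v)‖ₑ ^ 2 ∂μ := by
    intro x
    have hd : ∀ t : ℝ, HasDerivAt (fun t : ℝ => φ (x + t • v))
        (inner ℝ (gradient φ (x + t • v)) v) t := by
      intro t
      have h1 : HasDerivAt (fun t : ℝ => x + t • v) v t := by
        simpa using ((hasDerivAt_id t).smul_const v).const_add x
      rw [inner_gradient_left]
      exact (h.differentiable _).hasFDerivAt.comp_hasDerivAt t h1
    have hcont : Continuous fun t : ℝ => inner ℝ (gradient φ (x + t • v)) v :=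
      (hc.comp (by fun_prop)).inner continuous_const
    have := intervalIntegral.integral_eq_sub_of_hasDerivAt (a := 0) (b := 1)
      (fun t _ => hd t) (hcont.intervalIntegrable _ _)
    rw [intervalIntegral.integral_of_le zero_le_one] at this
    simp only [one_smul, zero_smul, add_zero] at this
    rw [← this]
    refine (enorm_integral_sq_le hcont.aestronglyMeasurable).trans (lintegral_mono fun t => ?_)
    rw [← mul_pow]
    gcongr
    rw [mul_comm]
    have := norm_inner_le_norm (𝕜 := ℝ) (gradient φ (x + t • v)) v
    simpa only [← ofReal_norm, ← ENNReal.ofReal_mul (norm_nonneg _)] using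
      ENNReal.ofReal_le_ofReal this
  calc ∫⁻ x, ‖φ (x + v) - φ x‖ₑ ^ 2
      ≤ ∫⁻ x, (∫⁻ t, ‖v‖ₑ ^ 2 * ‖gradient φ (x + t • v)‖ₑ ^ 2 ∂μ) := lintegral_mono hpt
    _ = ∫⁻ t, (∫⁻ x, ‖v‖ₑ ^ 2 * ‖gradient φ (x + t • v)‖ₑ ^ 2) ∂μ := by
        refine lintegral_lintegral_swap (Continuous.aemeasurable ?_)
        refine ENNReal.continuous_const_mul (by simp) |>.comp ((ENNReal.continuous_pow 2).comp ?_)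
        exact (hc.comp (by fun_prop)).enorm
    _ = ∫⁻ _, (‖v‖ₑ ^ 2 * ∫⁻ x, ‖gradient φ x‖ₑ ^ 2) ∂μ := by
        refine lintegral_congr fun t => ?_
        rw [lintegral_const_mul' _ _ (by simp)]
        rw [lintegral_add_right_eq_self (fun x => ‖gradient φ x‖ₑ ^ 2)]
    _ = _ := by simp

/-- The uniform probability measure on the ball of radius `δ` about the origin. -/
def ballMeasure (δ : ℝ) : Measure E3 := (volume (B δ))⁻¹ • volume.restrict (B δ)

lemma isProbabilityMeasure_ballMeasure {δ : ℝ} (hδ : 0 < δ) :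
    IsProbabilityMeasure (ballMeasure δ) := ⟨by
  have h0 : volume (B δ) ≠ 0 := (Metric.measure_ball_pos _ _ hδ).ne'
  rw [ballMeasure, Measure.smul_apply, Measure.restrict_apply_univ, smul_eq_mul,
    ENNReal.inv_mul_cancel h0 measure_ball_lt_top.ne]⟩

/-- The average of `φ` over the ball of radius `δ` about a point. -/
def ballAverage (δ : ℝ) (φ : E3 → ℝ) (x : E3) : ℝ := ∫ v, φ (x + v) ∂ballMeasure δ

lemma continuous_ballAverage {δ : ℝ} (hδ : 0 < δ) {φ : E3 → ℝ} (hφ : Continuous φ)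
    (hc : HasCompactSupport φ) : Continuous (ballAverage δ φ) := by
  have := isProbabilityMeasure_ballMeasure hδ
  obtain ⟨C, hC⟩ := hφ.bounded_above_of_compact_support hc
  exact continuous_of_dominated (bound := fun _ => C)
    (fun x => (hφ.comp (continuous_const.add continuous_id)).aestronglyMeasurable)
    (fun x => Eventually.of_forall fun v => hC _) (integrable_const _)
    (Eventually.of_forall fun v => by fun_prop)

/-- The quantitative form of Rellich's theorem: averaging over balls of radius `δ` moves a test
function in `L²` by at most `δ‖∇φ‖₂`. -/
lemma IsTestFunction.eLpNorm_sub_ballAverage_le {Ω : Set E3} {φ : E3 → ℝ}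
    (h : IsTestFunction Ω φ) {δ : ℝ} (hδ : 0 < δ) :
    eLpNorm (fun x => φ x - ballAverage δ φ x) 2 volume ≤
      ENNReal.ofReal δ * eLpNorm (gradient φ) 2 volume := by
  have := isProbabilityMeasure_ballMeasure hδ
  rw [← ENNReal.pow_le_pow_left_iff (n := 2) (by norm_num), mul_pow, eLpNorm_two_sq, eLpNorm_two_sq]
  obtain ⟨C, hC⟩ := h.continuous.bounded_above_of_compact_support h.2.1
  have hpt : ∀ x, ‖φ x - ballAverage δ φ x‖ₑ ^ 2 ≤
      ∫⁻ v, ‖φ (x + v) - φ x‖ₑ ^ 2 ∂ballMeasure δ := by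
    intro x
    have hcont : Continuous fun v => φ (x + v) := h.continuous.comp (by fun_prop)
    have hi : Integrable (fun v => φ (x + v)) (ballMeasure δ) :=
      Integrable.of_bound hcont.aestronglyMeasurable C (Eventually.of_forall fun v => hC _)
    have : ∫ v, (φ (x + v) - φ x) ∂ballMeasure δ = ballAverage δ φ x - φ x := by
      rw [integral_sub hi (integrable_const _)]
      simp [ballAverage]
    rw [← enorm_neg, neg_sub, ← this]
    exact enorm_integral_sq_le (hcont.sub continuous_const).aestronglyMeasurable
  calc ∫⁻ x, ‖φ x - ballAverage δ φ x‖ₑ ^ 2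
      ≤ ∫⁻ x, ∫⁻ v, ‖φ (x + v) - φ x‖ₑ ^ 2 ∂ballMeasure δ := lintegral_mono hpt
    _ = ∫⁻ v, (∫⁻ x, ‖φ (x + v) - φ x‖ₑ ^ 2) ∂ballMeasure δ := by
        refine lintegral_lintegral_swap (Continuous.aemeasurable ?_)
        refine (ENNReal.continuous_pow 2).comp ?_
        exact ((h.continuous.comp (by fun_prop)).sub (h.continuous.comp (by fun_prop))).enorm
    _ ≤ ∫⁻ _, (ENNReal.ofReal δ ^ 2 * ∫⁻ x, ‖gradient φ x‖ₑ ^ 2) ∂ballMeasure δ := by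
        have hae : ∀ᵐ v ∂ballMeasure δ, v ∈ B δ :=
          Measure.ae_smul_measure (ae_restrict_mem Metric.isOpen_ball.measurableSet) _
        refine lintegral_mono_ae ?_
        filter_upwards [hae] with v hv
        refine (h.lintegral_translate_sub_sq_le v).trans ?_
        gcongr
        rw [← ofReal_norm]
        exact ENNReal.ofReal_le_ofReal (by simpa using (mem_ball_zero_iff.1 hv).le)
    _ = _ := by simp

lemma ballAverage_eq (δ : ℝ) (φ : E3 → ℝ) (x : E3) :
    ballAverage δ φ x = (volume (B δ))⁻¹.toReal * ∫ z in Metric.ball x δ, φ z := by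
  rw [ballAverage, ballMeasure, integral_smul_measure, smul_eq_mul]
  congr 1
  rw [← integral_indicator Metric.isOpen_ball.measurableSet,
    ← integral_indicator Metric.isOpen_ball.measurableSet,
    ← integral_add_left_eq_self ((Metric.ball x δ).indicator φ) x]
  refine integral_congr_ae (Eventually.of_forall fun z => ?_)
  simp [indicator, Metric.mem_ball, dist_eq_norm]

/-- Ball averages are weakly continuous: they are inner products with a fixed element. -/
lemma exists_inner_eq_ballAverage {δ : ℝ} (x : E3) : ∃ w : GraphSpace,
    (∀ {Ω : Set E3} {φ : E3 → ℝ} (h : IsTestFunction Ω φ),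
      ballAverage δ φ x = inner ℝ h.graph w) ∧
      ‖w‖ = (volume (B δ))⁻¹.toReal * (volume (B δ)).toReal ^ (1 / 2 : ℝ) := by
  have hfin : volume (Metric.ball x δ) ≠ ⊤ := measure_ball_lt_top.ne
  refine ⟨WithLp.toLp 2 (indicatorConstLp 2 Metric.isOpen_ball.measurableSet hfin
    (volume (B δ))⁻¹.toReal, 0), fun h => ?_, ?_⟩
  · rw [ballAverage_eq, WithLp.prod_inner_apply]
    simp only [inner_zero_right, add_zero]
    rw [real_inner_comm, L2.inner_indicatorConstLp_eq_inner_setIntegral]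
    rw [RCLike.inner_apply, conj_trivial, mul_comm]
    congr 1
    exact setIntegral_congr_ae Metric.isOpen_ball.measurableSet
      (h.graph_fst.symm.mono fun z hz _ => hz)
  · have e := graphSpace_norm_sq (WithLp.toLp 2 (indicatorConstLp 2
      Metric.isOpen_ball.measurableSet hfin (volume (B δ))⁻¹.toReal,
      (0 : Lp E3 2 (volume : Measure E3))))
    simp only [WithLp.toLp_fst, WithLp.toLp_snd, norm_zero] at e
    rw [← sq_eq_sq₀ (norm_nonneg _) (by positivity), e,
      norm_indicatorConstLp (by norm_num) (by norm_num)]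
    rw [Measure.real, Measure.addHaar_ball_center]
    simp

lemma ballAverage_eq_zero_off {δ R : ℝ} {φ : E3 → ℝ} (h : IsTestFunction (B R) φ) {x : E3}
    (hx : x ∉ B (R + δ)) : ballAverage δ φ x = 0 := by
  rw [ballAverage_eq, setIntegral_eq_zero_of_forall_eq_zero, mul_zero]
  intro z hz
  by_contra hz0
  have h1 : z ∈ B R := h.2.2 (subset_tsupport _ hz0)
  refine hx ?_
  rw [mem_ball_zero_iff] at h1 ⊢
  rw [Metric.mem_ball, dist_eq_norm] at hz
  have : ‖x‖ ≤ ‖z‖ + ‖z - x‖ := by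
    have := norm_sub_le z (z - x)
    simpa using this
  linarith

lemma norm_fst_le (x : GraphSpace) : ‖x.fst‖ ≤ ‖x‖ := WithLp.norm_fst_le _ x

lemma norm_snd_le (x : GraphSpace) : ‖x.snd‖ ≤ ‖x‖ := WithLp.norm_snd_le _ x

/-- Rellich's theorem for test functions: weak convergence of the graphs forces strong
convergence of the functions. -/
lemma tendsto_fst_of_weak {R : ℝ} {φ : ℕ → E3 → ℝ} (h : ∀ n, IsTestFunction (B R) (φ n))
    {x : GraphSpace} {C : ℝ} (hC : ∀ n, ‖(h n).graph‖ ≤ C)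
    (hw : ∀ w, Tendsto (fun n => inner ℝ (h n).graph w) atTop (𝓝 (inner ℝ x w))) :
    Tendsto (fun n => (h n).graph.fst) atTop (𝓝 x.fst) := by
  have hcauchy : CauchySeq fun n => (h n).graph.fst := by
    rw [Metric.cauchySeq_iff']
    intro ε hε
    have hC0 : 0 ≤ C := (norm_nonneg _).trans (hC 0)
    obtain ⟨δ, hδ, hδε⟩ : ∃ δ : ℝ, 0 < δ ∧ δ * C < ε / 4 :=
      ⟨ε / (4 * (C + 1)), by positivity, by
        rw [div_mul_eq_mul_div, div_lt_div_iff₀ (by positivity) (by norm_num)]; nlinarith⟩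
    choose w hwa hwn using fun x : E3 => exists_inner_eq_ballAverage (δ := δ) x
    -- a bound, independent of the centre, for the norms of the averaging functionals
    let K := (volume (B δ))⁻¹.toReal * (volume (B δ)).toReal ^ (1 / 2 : ℝ)
    let b : E3 → ℝ := fun z => inner ℝ x (w z)
    have hb : ∀ z, Tendsto (fun n => ballAverage δ (φ n) z) atTop (𝓝 (b z)) := by
      intro z
      simp only [hwa z (h _)]
      exact hw _
    have hbd : ∀ n z, ‖ballAverage δ (φ n) z‖ ≤ C * K := by
      intro n z
      rw [hwa z (h n)]
      refine (norm_inner_le_norm _ _).trans ?_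
      rw [hwn]
      exact mul_le_mul_of_nonneg_right (hC n) (by positivity)
    have hbd' : ∀ z, ‖b z‖ ≤ C * K := fun z => le_of_tendsto (hb z).norm
      (Eventually.of_forall fun n => hbd n z)
    have hcont : ∀ n, Continuous (ballAverage δ (φ n)) := fun n =>
      continuous_ballAverage hδ (h n).continuous (h n).2.1
    have hbm : AEStronglyMeasurable b volume :=
      aestronglyMeasurable_of_tendsto_ae atTop (fun n => (hcont n).aestronglyMeasurable)
        (Eventually.of_forall hb)
    -- for fixed `δ` the averages converge pointwise, boundedly and in a fixed ball
    have hconv : Tendsto (fun n => eLpNorm (fun z => ballAverage δ (φ n) z - b z) 2 volume)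
        atTop (𝓝 0) := by
      refine tendsto_eLpNorm_zero_of_dominated
        (g := (B (R + δ)).indicator fun _ => C * K + C * K)
        (fun n => (hcont n).aestronglyMeasurable.sub hbm) ?_
        (fun n => Eventually.of_forall fun z => ?_)
        (Eventually.of_forall fun z => by simpa using (hb z).sub_const (b z))
      · exact memLp_indicator_const 2 Metric.isOpen_ball.measurableSet _
          (Or.inr measure_ball_lt_top.ne)
      · by_cases hz : z ∈ B (R + δ)
        · rw [indicator_of_mem hz]
          exact (norm_sub_le _ _).trans (add_le_add (hbd n z) (hbd' z))
        · have hz0 : ∀ n, ballAverage δ (φ n) z = 0 := fun n => ballAverage_eq_zero_off (h n) hz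
          have : b z = 0 := tendsto_nhds_unique (hb z) (by simp [hz0])
          simp [hz0, this, indicator_of_notMem hz]
    have hgrad : ∀ n, eLpNorm (fun z => φ n z - ballAverage δ (φ n) z) 2 volume ≤
        ENNReal.ofReal (ε / 4) := by
      intro n
      refine ((h n).eLpNorm_sub_ballAverage_le hδ).trans ?_
      have : eLpNorm (gradient (φ n)) 2 volume ≤ ENNReal.ofReal C := by
        rw [← eLpNorm_congr_ae (h n).graph_snd, ← Lp.enorm_def, ← ofReal_norm]
        exact ENNReal.ofReal_le_ofReal ((norm_snd_le _).trans (hC n))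
      calc _ ≤ ENNReal.ofReal δ * ENNReal.ofReal C := by gcongr
        _ = ENNReal.ofReal (δ * C) := (ENNReal.ofReal_mul hδ.le).symm
        _ ≤ _ := ENNReal.ofReal_le_ofReal hδε.le
    have hε4 : (0 : ℝ≥0∞) < ENNReal.ofReal (ε / 8) := by simpa using hε
    obtain ⟨N, hN⟩ := eventually_atTop.1 (hconv.eventually (gt_mem_nhds hε4))
    have hNb : ∀ n ≥ N, eLpNorm (fun z => φ n z - b z) 2 volume < ENNReal.ofReal (ε / 2) := by
      intro n hn
      have e : (fun z => φ n z - b z) = (fun z => φ n z - ballAverage δ (φ n) z) +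
          fun z => ballAverage δ (φ n) z - b z := by
        ext z; simp
      rw [e]
      refine (eLpNorm_add_le ((h n).continuous.sub (hcont n)).aestronglyMeasurable
        ((hcont n).aestronglyMeasurable.sub hbm) one_le_two).trans_lt ?_
      calc _ ≤ ENNReal.ofReal (ε / 4) + ENNReal.ofReal (ε / 8) :=
            add_le_add (hgrad n) (hN n hn).le
        _ = ENNReal.ofReal (ε / 4 + ε / 8) :=
            (ENNReal.ofReal_add (by positivity) (by positivity)).symm
        _ < _ := (ENNReal.ofReal_lt_ofReal_iff (by positivity)).2 (by linarith)
    refine ⟨N, fun n hn => ?_⟩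
    rw [dist_eq_norm, ← ENNReal.ofReal_lt_ofReal_iff hε, ofReal_norm, Lp.enorm_def]
    have e : eLpNorm ((h n).graph.fst - (h N).graph.fst : Lp ℝ 2 (volume : Measure E3)) 2 volume =
        eLpNorm ((fun z => φ n z - b z) - fun z => φ N z - b z) 2 volume := by
      refine eLpNorm_congr_ae ((Lp.coeFn_sub _ _).trans ?_)
      filter_upwards [(h n).graph_fst, (h N).graph_fst] with z h1 h2
      simp [h1, h2]
    rw [e]
    refine (eLpNorm_sub_le ((h n).continuous.aestronglyMeasurable.sub hbm)
      ((h N).continuous.aestronglyMeasurable.sub hbm) one_le_two).trans_lt ?_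
    calc _ < ENNReal.ofReal (ε / 2) + ENNReal.ofReal (ε / 2) :=
          ENNReal.add_lt_add (hNb n hn) (hNb N le_rfl)
      _ = ENNReal.ofReal ε := by
          rw [← ENNReal.ofReal_add (by positivity) (by positivity), add_halves]
  obtain ⟨f, hf⟩ := cauchySeq_tendsto_of_complete hcauchy
  suffices f = x.fst by rwa [← this]
  refine ext_inner_right ℝ fun v => ?_
  refine tendsto_nhds_unique (hf.inner tendsto_const_nhds) ?_
  have := hw (WithLp.toLp 2 (v, 0))
  simpa [WithLp.prod_inner_apply] using this

/-- Compactness in `H¹₀(B_R)`: a bounded sequence has a subsequence whose graphs converge weakly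
and whose functions converge strongly in `L²`. -/
theorem exists_subseq_sobolevGraph {R : ℝ} {x : ℕ → GraphSpace}
    (hx : ∀ n, x n ∈ sobolevGraph (B R)) {C : ℝ} (hC : ∀ n, ‖x n‖ ≤ C) :
    ∃ y ∈ sobolevGraph (B R), ∃ ns : ℕ → ℕ, StrictMono ns ∧
      Tendsto (fun n => (x (ns n)).fst) atTop (𝓝 y.fst) ∧
      ∀ w, Tendsto (fun n => inner ℝ (x (ns n)) w) atTop (𝓝 (inner ℝ y w)) := by
  obtain ⟨y, ns, hns, hy⟩ := exists_subseq_weak hC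
  refine ⟨y, mem_submodule_of_weak_tendsto (isClosed_sobolevGraph _) (fun n => hx _) hy, ns, hns,
    ?_, hy⟩
  have happ : ∀ n, ∃ (φ : E3 → ℝ) (h : IsTestFunction (B R) φ),
      ‖x (ns n) - h.graph‖ < 1 / ((n : ℝ) + 1) := by
    intro n
    obtain ⟨φ, h, hlim, -⟩ := exists_seq_testFunction (hx (ns n))
    obtain ⟨m, hm⟩ := (Metric.tendsto_atTop.1 hlim _ (Nat.one_div_pos_of_nat (n := n) (α := ℝ)))
    refine ⟨φ m, h m, ?_⟩
    have := hm m le_rfl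
    rwa [dist_comm, dist_eq_norm] at this
  choose φ h hφ using happ
  have hz : Tendsto (fun n => x (ns n) - (h n).graph) atTop (𝓝 0) :=
    squeeze_zero_norm (fun n => (hφ n).le) tendsto_one_div_add_atTop_nhds_zero_nat
  have hstrong : Tendsto (fun n => (h n).graph.fst) atTop (𝓝 y.fst) := by
    refine tendsto_fst_of_weak h (C := C + 1) (fun n => ?_) fun w => ?_
    · have h1 := norm_sub_norm_le (h n).graph (x (ns n))
      rw [norm_sub_rev] at h1
      have h2 : 1 / ((n : ℝ) + 1) ≤ 1 := by
        rw [div_le_one (by positivity)]; linarith [(n.cast_nonneg : (0 : ℝ) ≤ n)]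
      linarith [hφ n, hC (ns n)]
    · have := (hy w).sub (hz.inner (tendsto_const_nhds (x := w)))
      simpa [inner_sub_left] using this
  have := hstrong.add (graphSpace_tendsto_iff.1 hz).1
  simpa using this

/-! ### The Coulomb energy -/

/-- The `L¹(B_{2R})` norm of the Coulomb kernel `1/|z|`. -/
def coulombConst (R : ℝ) : ℝ≥0∞ := ∫⁻ z in B (2 * R), ‖‖z‖⁻¹‖ₑ

lemma coulombConst_lt_top (R : ℝ) : coulombConst R < ⊤ := by
  have h : IntegrableOn (fun z : E3 => ‖z‖⁻¹) (B (2 * R)) volume := by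
    refine (integrableOn_fun_norm_addHaar volume (f := fun r : ℝ => r⁻¹)).2 ?_
    have : IntegrableOn (fun r : ℝ => r) (Ioo 0 (2 * R)) :=
      (continuous_id.integrableOn_Icc).mono_set Ioo_subset_Icc_self
    refine this.congr_fun (fun r hr => ?_) measurableSet_Ioo
    have hr0 : r ≠ 0 := hr.1.ne'
    simp [pow_two, hr0]
  exact h.2

lemma lintegral_inv_norm_sub_le {R : ℝ} {x : E3} (hx : x ∈ B R) :
    ∫⁻ y in B R, ‖‖x - y‖⁻¹‖ₑ ≤ coulombConst R := by
  let k : E3 → ℝ≥0∞ := (B (2 * R)).indicator fun z => ‖‖z‖⁻¹‖ₑ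
  calc ∫⁻ y in B R, ‖‖x - y‖⁻¹‖ₑ ≤ ∫⁻ y in B R, k (x - y) := by
        refine setLIntegral_mono' Metric.isOpen_ball.measurableSet fun y hy => ?_
        have : x - y ∈ B (2 * R) := by
          rw [mem_ball_zero_iff] at hx hy ⊢
          linarith [norm_sub_le x y]
        simp only [k, indicator_of_mem this]
        exact le_rfl
    _ ≤ ∫⁻ y, k (x - y) := setLIntegral_le_lintegral _ _
    _ = ∫⁻ y, k y := lintegral_sub_left_eq_self k x
    _ = coulombConst R := lintegral_indicator Metric.isOpen_ball.measurableSet _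

lemma measurable_inv_norm_sub : Measurable fun p : E3 × E3 => ‖p.1 - p.2‖⁻¹ := by fun_prop

/-- The square root of the Coulomb kernel splits it between the two arguments. -/
lemma eLpNorm_mul_sqrt_inv_le {R : ℝ} {f : E3 → ℝ} (hf : AEStronglyMeasurable f volume) :
    eLpNorm (fun p : E3 × E3 => f p.1 * √(‖p.1 - p.2‖⁻¹)) 2
      ((volume.restrict (B R)).prod (volume.restrict (B R))) ^ 2 ≤
      coulombConst R * eLpNorm f 2 volume ^ 2 := by
  rw [eLpNorm_two_sq, eLpNorm_two_sq]
  have hsq : ∀ p : E3 × E3, ‖f p.1 * √(‖p.1 - p.2‖⁻¹)‖ₑ ^ 2 =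
      ‖f p.1‖ₑ ^ 2 * ‖‖p.1 - p.2‖⁻¹‖ₑ := by
    intro p
    rw [enorm_mul, mul_pow, ← enorm_pow √(‖p.1 - p.2‖⁻¹), Real.sq_sqrt (by positivity)]
  simp_rw [hsq]
  have hm : AEMeasurable (fun p : E3 × E3 => ‖f p.1‖ₑ ^ 2 * ‖‖p.1 - p.2‖⁻¹‖ₑ)
      ((volume.restrict (B R)).prod (volume.restrict (B R))) :=
    ((hf.restrict.comp_fst (ν := volume.restrict (B R))).enorm.pow_const 2).mul
      measurable_inv_norm_sub.enorm.aemeasurable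
  rw [lintegral_prod _ hm]
  calc ∫⁻ x in B R, (∫⁻ y in B R, ‖f x‖ₑ ^ 2 * ‖‖x - y‖⁻¹‖ₑ)
      ≤ ∫⁻ x in B R, coulombConst R * ‖f x‖ₑ ^ 2 := by
        refine setLIntegral_mono' Metric.isOpen_ball.measurableSet fun x hx => ?_
        rw [lintegral_const_mul' _ _ (by simp), mul_comm]
        gcongr
        exact lintegral_inv_norm_sub_le hx
    _ ≤ ∫⁻ x, coulombConst R * ‖f x‖ₑ ^ 2 := setLIntegral_le_lintegral _ _
    _ = _ := lintegral_const_mul' _ _ (coulombConst_lt_top R).ne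

lemma eLpNorm_mul_sqrt_inv_le' {R : ℝ} {f : E3 → ℝ} (hf : AEStronglyMeasurable f volume) :
    eLpNorm (fun p : E3 × E3 => f p.2 * √(‖p.1 - p.2‖⁻¹)) 2
      ((volume.restrict (B R)).prod (volume.restrict (B R))) ^ 2 ≤
      coulombConst R * eLpNorm f 2 volume ^ 2 := by
  refine le_trans (le_of_eq ?_) (eLpNorm_mul_sqrt_inv_le hf)
  rw [eLpNorm_two_sq, eLpNorm_two_sq]
  rw [← lintegral_prod_swap]
  simp [norm_sub_rev]

lemma memLp_mul_sqrt_inv {R : ℝ} {f : E3 → ℝ} (hf : MemLp f 2 volume) :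
    MemLp (fun p : E3 × E3 => f p.1 * √(‖p.1 - p.2‖⁻¹)) 2
      ((volume.restrict (B R)).prod (volume.restrict (B R))) := by
  refine ⟨(hf.1.restrict.comp_fst (ν := volume.restrict (B R))).mul
    measurable_inv_norm_sub.sqrt.aestronglyMeasurable, ?_⟩
  have := (eLpNorm_mul_sqrt_inv_le (R := R) hf.1).trans_lt
    (ENNReal.mul_lt_top (coulombConst_lt_top R) (ENNReal.pow_lt_top hf.2))
  exact (ENNReal.pow_lt_top_iff.1 this).resolve_right (by norm_num)

lemma memLp_mul_sqrt_inv' {R : ℝ} {f : E3 → ℝ} (hf : MemLp f 2 volume) :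
    MemLp (fun p : E3 × E3 => f p.2 * √(‖p.1 - p.2‖⁻¹)) 2
      ((volume.restrict (B R)).prod (volume.restrict (B R))) := by
  refine ⟨(hf.1.restrict.comp_snd (μ := volume.restrict (B R))).mul
    measurable_inv_norm_sub.sqrt.aestronglyMeasurable, ?_⟩
  have := (eLpNorm_mul_sqrt_inv_le' (R := R) hf.1).trans_lt
    (ENNReal.mul_lt_top (coulombConst_lt_top R) (ENNReal.pow_lt_top hf.2))
  exact (ENNReal.pow_lt_top_iff.1 this).resolve_right (by norm_num)

lemma mul_sqrt_inv_mul (f g : E3 → ℝ) (p : E3 × E3) :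
    (f p.1 * √(‖p.1 - p.2‖⁻¹)) * (g p.2 * √(‖p.1 - p.2‖⁻¹)) = f p.1 * g p.2 / ‖p.1 - p.2‖ := by
  have : √(‖p.1 - p.2‖⁻¹) * √(‖p.1 - p.2‖⁻¹) = ‖p.1 - p.2‖⁻¹ := Real.mul_self_sqrt (by positivity)
  rw [mul_mul_mul_comm, this, div_eq_mul_inv]

lemma integrable_coulomb {R : ℝ} {f g : E3 → ℝ} (hf : MemLp f 2 volume) (hg : MemLp g 2 volume) :
    Integrable (fun p : E3 × E3 => f p.1 * g p.2 / ‖p.1 - p.2‖)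
      ((volume.restrict (B R)).prod (volume.restrict (B R))) := by
  have := (memLp_mul_sqrt_inv (R := R) hf).integrable_mul (memLp_mul_sqrt_inv' (R := R) hg)
  exact this.congr (Eventually.of_forall fun p => mul_sqrt_inv_mul f g p)

lemma coulomb_eq_integral_prod {R : ℝ} {f g : E3 → ℝ} (hf : MemLp f 2 volume)
    (hg : MemLp g 2 volume) : coulomb (B R) f g =
      ∫ p, f p.1 * g p.2 / ‖p.1 - p.2‖ ∂((volume.restrict (B R)).prod (volume.restrict (B R))) :=
  (integral_prod _ (integrable_coulomb hf hg)).symm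

/-- The Coulomb energy is a bounded bilinear form on `L²`. -/
lemma abs_coulomb_le {R : ℝ} (f g : Lp ℝ 2 (volume : Measure E3)) :
    |coulomb (B R) f g| ≤ (coulombConst R).toReal * (‖f‖ * ‖g‖) := by
  have hf := Lp.memLp f
  have hg := Lp.memLp g
  rw [coulomb_eq_integral_prod hf hg]
  let μ := (volume.restrict (B R)).prod (volume.restrict (B R))
  let F := fun p : E3 × E3 => f p.1 * √(‖p.1 - p.2‖⁻¹)
  let G := fun p : E3 × E3 => g p.2 * √(‖p.1 - p.2‖⁻¹)
  have hF : MemLp F 2 μ := memLp_mul_sqrt_inv hf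
  have hG : MemLp G 2 μ := memLp_mul_sqrt_inv' hg
  have h1 : ∫ p, f p.1 * g p.2 / ‖p.1 - p.2‖ ∂μ = inner ℝ (hG.toLp G) (hF.toLp F) := by
    rw [L2.inner_def]
    refine integral_congr_ae ?_
    filter_upwards [hF.coeFn_toLp, hG.coeFn_toLp] with p hp hp'
    rw [hp, hp']
    simp only [RCLike.inner_apply, conj_trivial]
    exact (mul_sqrt_inv_mul f g p).symm
  have hκ := (coulombConst_lt_top R).ne
  have hFn : ‖hF.toLp F‖ ≤ √(coulombConst R).toReal * ‖f‖ := by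
    rw [← sq_le_sq₀ (norm_nonneg _) (by positivity), mul_pow, Real.sq_sqrt (by positivity),
      Lp.norm_toLp, Lp.norm_def, ← ENNReal.toReal_pow, ← ENNReal.toReal_pow, ← ENNReal.toReal_mul]
    exact ENNReal.toReal_mono (ENNReal.mul_ne_top hκ (ENNReal.pow_ne_top hf.2.ne))
      (eLpNorm_mul_sqrt_inv_le hf.1)
  have hGn : ‖hG.toLp G‖ ≤ √(coulombConst R).toReal * ‖g‖ := by
    rw [← sq_le_sq₀ (norm_nonneg _) (by positivity), mul_pow, Real.sq_sqrt (by positivity),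
      Lp.norm_toLp, Lp.norm_def, ← ENNReal.toReal_pow, ← ENNReal.toReal_pow, ← ENNReal.toReal_mul]
    exact ENNReal.toReal_mono (ENNReal.mul_ne_top hκ (ENNReal.pow_ne_top hg.2.ne))
      (eLpNorm_mul_sqrt_inv_le' hg.1)
  calc |∫ p, f p.1 * g p.2 / ‖p.1 - p.2‖ ∂μ| ≤ ‖hG.toLp G‖ * ‖hF.toLp F‖ := by
        rw [h1]; exact abs_real_inner_le_norm _ _
    _ ≤ (√(coulombConst R).toReal * ‖g‖) * (√(coulombConst R).toReal * ‖f‖) := by gcongr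
    _ = (√(coulombConst R).toReal * √(coulombConst R).toReal) * (‖f‖ * ‖g‖) := by ring
    _ = _ := by rw [Real.mul_self_sqrt (by positivity)]

lemma coulomb_congr_ae (Ω : Set E3) {f f' g g' : E3 → ℝ} (hf : f =ᵐ[volume] f')
    (hg : g =ᵐ[volume] g') : coulomb Ω f g = coulomb Ω f' g' := by
  refine integral_congr_ae ?_
  filter_upwards [ae_restrict_of_ae hf] with x hx
  refine integral_congr_ae ?_
  filter_upwards [ae_restrict_of_ae hg] with y hy
  rw [hx, hy]

/-- The Coulomb energy is locally Lipschitz in `L²`. -/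
lemma abs_coulomb_self_sub_le {R : ℝ} (f g : Lp ℝ 2 (volume : Measure E3)) :
    |coulomb (B R) f f - coulomb (B R) g g| ≤
      (coulombConst R).toReal * (‖f - g‖ * (‖f‖ + ‖g‖)) := by
  have hf := Lp.memLp f
  have hg := Lp.memLp g
  have hs := Lp.coeFn_sub f g
  have e : coulomb (B R) f f - coulomb (B R) g g =
      coulomb (B R) (f - g : Lp ℝ 2 (volume : Measure E3)) f +
        coulomb (B R) g (f - g : Lp ℝ 2 (volume : Measure E3)) := by
    rw [coulomb_congr_ae _ hs (ae_eq_refl f), coulomb_congr_ae _ (ae_eq_refl g) hs,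
      coulomb_eq_integral_prod hf hf, coulomb_eq_integral_prod hg hg,
      coulomb_eq_integral_prod (hf.sub hg) hf, coulomb_eq_integral_prod hg (hf.sub hg),
      ← integral_sub (integrable_coulomb hf hf) (integrable_coulomb hg hg),
      ← integral_add (integrable_coulomb (hf.sub hg) hf) (integrable_coulomb hg (hf.sub hg))]
    refine integral_congr_ae (Eventually.of_forall fun p => ?_)
    simp only [Pi.sub_apply]
    ring
  rw [e]
  have h1 := abs_coulomb_le (R := R) (f - g) f
  have h2 := abs_coulomb_le (R := R) g (f - g)
  calc _ ≤ _ := abs_add_le _ _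
    _ ≤ _ := add_le_add h1 h2
    _ = _ := by ring

/-- A kernel that is a superposition of nonnegative kernels with nonnegative quadratic forms has
a nonnegative quadratic form. -/
lemma quadForm_nonneg_of_superposition {Z : Type*} [MeasurableSpace Z] {ν : Measure Z} [SFinite ν]
    {μ : Measure E3} [SFinite μ] {u : E3 → ℝ} (hu : AEStronglyMeasurable u μ) {K : E3 × E3 → ℝ}
    {k : E3 × E3 → Z → ℝ} (hk0 : ∀ p z, 0 ≤ k p z) (hkm : Measurable (Function.uncurry k))
    (hk : ∀ᵐ p ∂μ.prod μ, Integrable (k p) ν ∧ ∫ z, k p z ∂ν = K p)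
    (hK : Integrable (fun p => u p.1 * u p.2 * K p) (μ.prod μ))
    (hpos : ∀ᵐ z ∂ν, 0 ≤ ∫ p, u p.1 * u p.2 * k p z ∂μ.prod μ) :
    0 ≤ ∫ p, u p.1 * u p.2 * K p ∂μ.prod μ := by
  have huu : AEStronglyMeasurable (fun p : E3 × E3 => u p.1 * u p.2) (μ.prod μ) :=
    hu.comp_fst.mul hu.comp_snd
  have hm : AEStronglyMeasurable (fun q : (E3 × E3) × Z => u q.1.1 * u q.1.2 * k q.1 q.2)
      ((μ.prod μ).prod ν) := (huu.comp_fst (ν := ν)).mul hkm.aestronglyMeasurable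
  have hint : Integrable (fun q : (E3 × E3) × Z => u q.1.1 * u q.1.2 * k q.1 q.2)
      ((μ.prod μ).prod ν) := by
    rw [integrable_prod_iff hm]
    constructor
    · filter_upwards [hk] with p hp
      exact hp.1.const_mul _
    · refine hK.norm.congr ?_
      filter_upwards [hk] with p hp
      simp only [norm_mul]
      rw [integral_const_mul, ← hp.2, Real.norm_of_nonneg (integral_nonneg (hk0 p))]
      simp only [Real.norm_of_nonneg (hk0 p _)]
  have e : ∫ p, u p.1 * u p.2 * K p ∂μ.prod μ =
      ∫ p, (∫ z, u p.1 * u p.2 * k p z ∂ν) ∂μ.prod μ := by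
    refine integral_congr_ae ?_
    filter_upwards [hk] with p hp
    rw [integral_const_mul, hp.2]
  rw [e, integral_integral_swap hint]
  exact integral_nonneg_of_ae hpos

/-- Gaussian kernels are positive definite, being self-convolutions of Gaussians. -/
lemma gaussian_nonneg {μ : Measure E3} [IsFiniteMeasure μ] {u : E3 → ℝ} (hu : Integrable u μ)
    {t : ℝ} (ht : 0 < t) :
    0 ≤ ∫ p : E3 × E3, u p.1 * u p.2 * Real.exp (-t * ‖p.1 - p.2‖ ^ 2) ∂μ.prod μ := by
  let c : ℝ := ∫ z : E3, Real.exp (-(4 * t) * ‖z‖ ^ 2)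
  have hcv : c = (Real.pi / (4 * t)) ^ ((Module.finrank ℝ E3 : ℝ) / 2) :=
    GaussianFourier.integral_rexp_neg_mul_sq_norm (by positivity)
  have hc : 0 < c := by rw [hcv]; positivity
  have hgi : Integrable fun z : E3 => Real.exp (-(4 * t) * ‖z‖ ^ 2) :=
    Integrable.of_integral_ne_zero hc.ne'
  -- the parallelogram identity about the midpoint of `x` and `y`
  have key : ∀ x y z : E3, Real.exp (-(2 * t) * ‖x - z‖ ^ 2) * Real.exp (-(2 * t) * ‖y - z‖ ^ 2) =
      Real.exp (-t * ‖x - y‖ ^ 2) *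
        Real.exp (-(4 * t) * ‖z + (-(1 / 2 : ℝ)) • (x + y)‖ ^ 2) := by
    intro x y z
    rw [← Real.exp_add, ← Real.exp_add]
    congr 1
    have h1 := parallelogram_law_with_norm ℝ (x - z) (y - z)
    have h2 : (x - z) + (y - z) = (-2 : ℝ) • (z + (-(1 / 2 : ℝ)) • (x + y)) := by module
    have h3 : (x - z) - (y - z) = x - y := by abel
    rw [h2, h3, norm_smul, Real.norm_eq_abs, abs_neg, abs_two] at h1
    linear_combination t * h1
  have h := quadForm_nonneg_of_superposition (ν := (volume : Measure E3)) (u := u)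
    (K := fun p => Real.exp (-t * ‖p.1 - p.2‖ ^ 2) * c)
    (k := fun p z => Real.exp (-(2 * t) * ‖p.1 - z‖ ^ 2) * Real.exp (-(2 * t) * ‖p.2 - z‖ ^ 2))
    hu.1 (fun p z => by positivity) (by fun_prop) (Eventually.of_forall fun p => ?_) ?_
    (Eventually.of_forall fun z => ?_)
  · have e : ∀ p : E3 × E3, u p.1 * u p.2 * (Real.exp (-t * ‖p.1 - p.2‖ ^ 2) * c) =
        u p.1 * u p.2 * Real.exp (-t * ‖p.1 - p.2‖ ^ 2) * c := fun p => by ring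
    simp only [e] at h
    rw [integral_mul_const] at h
    exact nonneg_of_mul_nonneg_left h hc
  · simp only [key]
    exact ⟨(hgi.comp_add_right _).const_mul _, by
      rw [integral_const_mul, integral_add_right_eq_self
        (fun z : E3 => Real.exp (-(4 * t) * ‖z‖ ^ 2))]⟩
  · refine (hu.mul_prod hu).mul_bdd (c := c) ?_ (Eventually.of_forall fun p => ?_)
    · exact Measurable.aestronglyMeasurable (by fun_prop)
    · rw [Real.norm_of_nonneg (by positivity)]
      refine mul_le_of_le_one_left hc.le (Real.exp_le_one_iff.2 ?_)
      have : 0 ≤ t * ‖p.1 - p.2‖ ^ 2 := by positivity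
      linarith
  · have e : ∀ p : E3 × E3, u p.1 * u p.2 *
        (Real.exp (-(2 * t) * ‖p.1 - z‖ ^ 2) * Real.exp (-(2 * t) * ‖p.2 - z‖ ^ 2)) =
        (u p.1 * Real.exp (-(2 * t) * ‖p.1 - z‖ ^ 2)) *
          (u p.2 * Real.exp (-(2 * t) * ‖p.2 - z‖ ^ 2)) := fun p => by ring
    simp only [e]
    rw [integral_prod_mul (fun x => u x * Real.exp (-(2 * t) * ‖x - z‖ ^ 2))
      (fun x => u x * Real.exp (-(2 * t) * ‖x - z‖ ^ 2))]
    exact mul_self_nonneg _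

lemma ae_prod_ne (μ ν : Measure E3) [SFinite ν] [NullSingletonClass ν] :
    ∀ᵐ p ∂μ.prod ν, p.1 ≠ p.2 := by
  have hd : MeasurableSet {p : E3 × E3 | p.1 = p.2} :=
    measurableSet_eq_fun measurable_fst measurable_snd
  have : μ.prod ν {p : E3 × E3 | p.1 = p.2} = 0 := by
    rw [Measure.measure_prod_null hd]
    refine Eventually.of_forall fun x => ?_
    have : Prod.mk x ⁻¹' {p : E3 × E3 | p.1 = p.2} = {x} := by ext y; simp [eq_comm]
    simp [this]
  simpa [ae_iff] using this

/-- The Coulomb energy is positive: `1/r` is a superposition of the Gaussians `exp(-s²r²)`, and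
each Gaussian is the convolution of a Gaussian with itself. -/
theorem coulomb_self_nonneg {R : ℝ} {u : E3 → ℝ} (hu : MemLp u 2 volume) :
    0 ≤ coulomb (B R) u u := by
  rw [coulomb_eq_integral_prod hu hu]
  have hfin : IsFiniteMeasure ((volume : Measure E3).restrict (B R)) :=
    ⟨by rw [Measure.restrict_apply_univ]; exact measure_ball_lt_top⟩
  have hui : Integrable u (volume.restrict (B R)) :=
    (hu.restrict (B R)).integrable one_le_two
  have h := quadForm_nonneg_of_superposition (ν := (volume : Measure ℝ))
    (μ := volume.restrict (B R)) (u := u)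
    (K := fun p => √Real.pi * ‖p.1 - p.2‖⁻¹)
    (k := fun p s => Real.exp (-‖p.1 - p.2‖ ^ 2 * s ^ 2))
    hui.1 (fun p z => by positivity) (by fun_prop) ?_ ?_ ?_
  · have e : ∀ p : E3 × E3, u p.1 * u p.2 * (√Real.pi * ‖p.1 - p.2‖⁻¹) =
        √Real.pi * (u p.1 * u p.2 / ‖p.1 - p.2‖) := fun p => by rw [div_eq_mul_inv]; ring
    simp only [e] at h
    rw [integral_const_mul] at h
    exact nonneg_of_mul_nonneg_right h (by positivity)
  · filter_upwards [ae_prod_ne (volume.restrict (B R)) (volume.restrict (B R))] with p hp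
    have hr : 0 < ‖p.1 - p.2‖ := norm_pos_iff.2 (sub_ne_zero.2 hp)
    refine ⟨integrable_exp_neg_mul_sq (by positivity), ?_⟩
    rw [integral_gaussian, Real.sqrt_div' _ (by positivity), Real.sqrt_sq hr.le, div_eq_mul_inv]
  · have := (integrable_coulomb (R := R) hu hu).const_mul √Real.pi
    refine this.congr (Eventually.of_forall fun p => ?_)
    simp only [div_eq_mul_inv]
    ring
  · have : ∀ᵐ s : ℝ, s ≠ 0 := by simp [ae_iff]
    filter_upwards [this] with s hs
    have := gaussian_nonneg hui (t := s ^ 2) (by positivity)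
    simpa only [neg_mul, mul_comm (s ^ 2)] using this

/-! ### The energy in the graph space and the existence of minimizers -/

section fEta

variable {η : ℝ}

/-- The slope of `f_η` is at least `η`, as `η ≤ 1/η`. -/
lemma mul_sub_le_fEta_sub (hη : η ∈ Ioo (0 : ℝ) 1) {s s' : ℝ} (h : s' ≤ s) :
    η * (s - s') ≤ fEta η s - fEta η s' := by
  have h1 : η ≤ 1 / η := by
    rw [le_div_iff₀ hη.1]
    nlinarith [hη.1, hη.2]
  unfold fEta
  split_ifs with a b b
  · linarith
  · exact absurd (h.trans a) b
  · push Not at a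
    nlinarith [mul_nonneg (sub_nonneg.2 h1) (sub_nonneg.2 a.le)]
  · nlinarith [mul_nonneg (sub_nonneg.2 h1) (sub_nonneg.2 h)]

lemma fEta_mono (hη : η ∈ Ioo (0 : ℝ) 1) : Monotone (fEta η) := fun s' s h => by
  have := mul_sub_le_fEta_sub hη h
  nlinarith [mul_nonneg hη.1.le (sub_nonneg.2 h)]

lemma continuous_fEta (η : ℝ) : Continuous (fEta η) := by
  refine Continuous.if_le (by fun_prop) (by fun_prop) continuous_id continuous_const ?_
  intro s hs
  have hs' : s = volume.real (B 1) := hs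
  simp [hs']

lemma fEta_zero (η : ℝ) : fEta η 0 = -(η * volume.real (B 1)) := by
  rw [fEta, if_pos measureReal_nonneg]; ring

end fEta

/-- The volume of `{u ≠ 0}` for a point `(u, ∇u)` of the graph space. -/
def graphVolume (x : GraphSpace) : ℝ := volume.real {z | x.fst z ≠ 0}

/-- The functional `𝓔_{q,M,η}` on the graph space. -/
def graphEnergy (R q M η : ℝ) (x : GraphSpace) : ℝ :=
  ‖x.snd‖ ^ 2 + q / 2 * coulomb (B R) x.fst x.fst + M * |‖x.fst‖ ^ 2 - 1| +
    fEta η (graphVolume x)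

lemma measurableSet_ne_zero (x : GraphSpace) : MeasurableSet {z | x.fst z ≠ 0} :=
  (measurableSet_eq_fun (Lp.stronglyMeasurable x.fst).measurable measurable_const).compl

lemma ne_zero_ae_le {R : ℝ} {x : GraphSpace} (hx : x ∈ sobolevGraph (B R)) :
    {z | x.fst z ≠ 0} ≤ᵐ[volume] B R := by
  filter_upwards [ae_eq_zero_off hx] with z hz h0
  by_contra hzR
  exact h0 (hz hzR).1

lemma volume_ne_zero_le {R : ℝ} {x : GraphSpace} (hx : x ∈ sobolevGraph (B R)) :
    volume {z | x.fst z ≠ 0} ≤ volume (B R) := measure_mono_ae (ne_zero_ae_le hx)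

lemma volume_ne_zero_ne_top {R : ℝ} {x : GraphSpace} (hx : x ∈ sobolevGraph (B R)) :
    volume {z | x.fst z ≠ 0} ≠ ⊤ := ((volume_ne_zero_le hx).trans_lt measure_ball_lt_top).ne

lemma graphVolume_le {R : ℝ} {x : GraphSpace} (hx : x ∈ sobolevGraph (B R)) :
    graphVolume x ≤ volume.real (B R) :=
  ENNReal.toReal_mono measure_ball_lt_top.ne (volume_ne_zero_le hx)

lemma energy_eq {R : ℝ} (q M η : ℝ) {x : GraphSpace} (hx : x ∈ sobolevGraph (B R)) {u : E3 → ℝ}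
    (hu : u =ᵐ[volume] x.fst) : energy R q M η u = graphEnergy R q M η x := by
  have hoff := ae_eq_zero_off hx
  have e1 : ∫ z in B R, ‖weakGrad u z‖ ^ 2 = ‖x.snd‖ ^ 2 := by
    rw [← integral_norm_sq_eq, setIntegral_eq_integral_of_ae_compl_eq_zero]
    · refine integral_congr_ae ?_
      filter_upwards [weakGrad_ae_eq hx hu] with z hz
      rw [hz]
    · filter_upwards [weakGrad_ae_eq hx hu, hoff] with z hz h0 hzR
      simp [hz, (h0 hzR).2]
  have e2 : ∫ z in B R, u z ^ 2 = ‖x.fst‖ ^ 2 := by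
    rw [← integral_norm_sq_eq, setIntegral_eq_integral_of_ae_compl_eq_zero]
    · refine integral_congr_ae ?_
      filter_upwards [hu] with z hz
      simp [hz]
    · filter_upwards [hu, hoff] with z hz h0 hzR
      simp [hz, (h0 hzR).1]
  have e3 : volume.real {z | u z ≠ 0} = graphVolume x := by
    refine measureReal_congr ?_
    filter_upwards [hu] with z hz
    exact congrArg (· ≠ 0) hz
  rw [energy, graphEnergy, e1, e2, e3, coulomb_congr_ae _ hu hu]

lemma isMinimizer_iff {R q M η : ℝ} {x : GraphSpace} (hx : x ∈ sobolevGraph (B R)) {u : E3 → ℝ}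
    (hu : u =ᵐ[volume] x.fst) : IsMinimizer R q M η u ↔
      ∀ y ∈ sobolevGraph (B R), graphEnergy R q M η x ≤ graphEnergy R q M η y := by
  constructor
  · rintro ⟨-, h⟩ y hy
    have := h y.fst (mem_H10_iff.2 ⟨y, hy, ae_eq_refl _⟩)
    rwa [energy_eq q M η hx hu, energy_eq q M η hy (ae_eq_refl _)] at this
  · intro h
    refine ⟨mem_H10_iff.2 ⟨x, hx, hu⟩, fun v hv => ?_⟩
    obtain ⟨y, hy, hvy⟩ := mem_H10_iff.1 hv
    rw [energy_eq q M η hx hu, energy_eq q M η hy hvy]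
    exact h y hy

/-- Coercivity of the energy. -/
lemma le_graphEnergy {R q M η : ℝ} (hq : 0 ≤ q) (hη : η ∈ Ioo (0 : ℝ) 1) (x : GraphSpace) :
    ‖x.snd‖ ^ 2 + M * |‖x.fst‖ ^ 2 - 1| - η * volume.real (B 1) ≤ graphEnergy R q M η x := by
  have h1 := coulomb_self_nonneg (R := R) (Lp.memLp x.fst)
  have h2 : fEta η 0 ≤ fEta η (graphVolume x) := fEta_mono hη measureReal_nonneg
  rw [fEta_zero] at h2
  have h3 : 0 ≤ q / 2 * coulomb (B R) x.fst x.fst := by positivity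
  unfold graphEnergy
  linarith

/-- Lower semicontinuity of the volume of `{u ≠ 0}`, by Fatou's lemma. -/
lemma graphVolume_le_of_tendsto {x : ℕ → GraphSpace} {y : GraphSpace} {R : ℝ}
    (hx : ∀ n, x n ∈ sobolevGraph (B R))
    (hae : ∀ᵐ z, Tendsto (fun n => (x n).fst z) atTop (𝓝 (y.fst z))) {m : ℝ}
    (hm : Tendsto (fun n => graphVolume (x n)) atTop (𝓝 m)) : graphVolume y ≤ m := by
  have hm0 : 0 ≤ m := ge_of_tendsto hm (Eventually.of_forall fun n => measureReal_nonneg)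
  refine ENNReal.toReal_le_of_le_ofReal hm0 ?_
  have hvol : ∀ n, volume {z | (x n).fst z ≠ 0} = ENNReal.ofReal (graphVolume (x n)) := fun n =>
    (ENNReal.ofReal_toReal (volume_ne_zero_ne_top (hx n))).symm
  have hlim : liminf (fun n => volume {z | (x n).fst z ≠ 0}) atTop = ENNReal.ofReal m := by
    simp only [hvol]
    exact ((ENNReal.continuous_ofReal.tendsto m).comp hm).liminf_eq
  rw [← hlim, ← lintegral_indicator_one (measurableSet_ne_zero y)]
  simp only [← lintegral_indicator_one (measurableSet_ne_zero (x _))]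
  refine le_trans (lintegral_mono_ae ?_) (lintegral_liminf_le fun n =>
    measurable_one.indicator (measurableSet_ne_zero (x n)))
  filter_upwards [hae] with z hz
  by_cases h0 : y.fst z = 0
  · simp [h0]
  · refine le_liminf_of_le (by isBoundedDefault) ?_
    filter_upwards [hz.eventually_ne h0] with n hn
    simp [hn, h0]

/-- Weak lower semicontinuity of the Dirichlet energy. -/
lemma norm_snd_sq_le_of_weak {x : ℕ → GraphSpace} {y : GraphSpace}
    (hw : ∀ w, Tendsto (fun n => inner ℝ (x n) w) atTop (𝓝 (inner ℝ y w))) {a : ℝ}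
    (ha : Tendsto (fun n => ‖(x n).snd‖ ^ 2) atTop (𝓝 a)) : ‖y.snd‖ ^ 2 ≤ a := by
  have h := hw (WithLp.toLp 2 (0, y.snd))
  simp only [WithLp.prod_inner_apply, inner_zero_right, zero_add] at h
  have h2 : inner ℝ y.snd y.snd ≤ (a + ‖y.snd‖ ^ 2) / 2 := by
    refine le_of_tendsto_of_tendsto h ((ha.add_const (‖y.snd‖ ^ 2)).div_const 2)
      (Eventually.of_forall fun n => ?_)
    have h1 := real_inner_le_norm (x n).snd y.snd
    have h2 := two_mul_le_add_sq ‖(x n).snd‖ ‖y.snd‖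
    change inner ℝ (x n).snd y.snd ≤ _
    simp only
    linarith
  rw [real_inner_self_eq_norm_sq] at h2
  linarith

/-- The direct method. -/
theorem exists_graphEnergy_min {R q M η : ℝ} (hM : 0 < M) (hq : 0 ≤ q)
    (hη : η ∈ Ioo (0 : ℝ) 1) : ∃ y ∈ sobolevGraph (B R), ∀ x ∈ sobolevGraph (B R),
      graphEnergy R q M η y ≤ graphEnergy R q M η x := by
  let S : Set ℝ := graphEnergy R q M η '' (sobolevGraph (B R) : Set GraphSpace)
  have hSne : S.Nonempty := ⟨_, 0, (sobolevGraph (B R)).zero_mem, rfl⟩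
  have hSbdd : BddBelow S := by
    refine ⟨-(η * volume.real (B 1)), ?_⟩
    rintro _ ⟨x, -, rfl⟩
    have h1 := le_graphEnergy (R := R) (M := M) hq hη x
    have h2 : 0 ≤ ‖x.snd‖ ^ 2 + M * |‖x.fst‖ ^ 2 - 1| := by positivity
    linarith
  obtain ⟨s, -, hs, hsS⟩ := exists_seq_tendsto_sInf hSne hSbdd
  choose x hx hxs using hsS
  obtain ⟨D, hD⟩ := hs.bddAbove_range
  let D' := D + η * volume.real (B 1)
  have hxD : ∀ n, ‖(x n).snd‖ ^ 2 + M * |‖(x n).fst‖ ^ 2 - 1| ≤ D' := by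
    intro n
    have h1 := le_graphEnergy (R := R) (M := M) hq hη (x n)
    have h2 := hD (mem_range_self n)
    rw [hxs] at h1
    simp only [D']
    linarith
  have hD'0 : 0 ≤ D' := le_trans (by positivity) (hxD 0)
  have hsnd : ∀ n, ‖(x n).snd‖ ^ 2 ∈ Icc 0 D' := fun n => ⟨by positivity, by
    have : 0 ≤ M * |‖(x n).fst‖ ^ 2 - 1| := by positivity
    linarith [hxD n]⟩
  have hbd : ∀ n, ‖x n‖ ≤ √(1 + D' / M + D') := by
    intro n
    refine Real.le_sqrt_of_sq_le ?_
    rw [graphSpace_norm_sq]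
    have h1 : |‖(x n).fst‖ ^ 2 - 1| ≤ D' / M := by
      rw [le_div_iff₀ hM, mul_comm]
      linarith [hxD n, sq_nonneg ‖(x n).snd‖]
    linarith [le_abs_self (‖(x n).fst‖ ^ 2 - 1), (hsnd n).2]
  obtain ⟨y, hy, ns, hns, hstrong, hweak⟩ := exists_subseq_sobolevGraph hx hbd
  obtain ⟨ms, hms, hae⟩ := (tendstoInMeasure_of_tendsto_Lp hstrong).exists_seq_tendsto_ae
  -- the Dirichlet energies and the volumes converge along a further subsequence
  obtain ⟨⟨a, m⟩, -, ks, hks, ham⟩ :=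
    ((isCompact_Icc (a := (0 : ℝ)) (b := D')).prod
      (isCompact_Icc (a := (0 : ℝ)) (b := volume.real (B R)))).tendsto_subseq
      (x := fun n => (‖(x (ns (ms n))).snd‖ ^ 2, graphVolume (x (ns (ms n)))))
      (fun n => ⟨hsnd _, measureReal_nonneg, graphVolume_le (hx _)⟩)
  let z : ℕ → GraphSpace := fun n => x (ns (ms (ks n)))
  have hmk : Tendsto (fun n => ms (ks n)) atTop atTop :=
    hms.tendsto_atTop.comp hks.tendsto_atTop
  have ha : Tendsto (fun n => ‖(z n).snd‖ ^ 2) atTop (𝓝 a) :=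
    (continuous_fst.tendsto _).comp ham
  have hm : Tendsto (fun n => graphVolume (z n)) atTop (𝓝 m) :=
    (continuous_snd.tendsto _).comp ham
  have hz : Tendsto (fun n => (z n).fst) atTop (𝓝 y.fst) := hstrong.comp hmk
  have hzw : ∀ w, Tendsto (fun n => inner ℝ (z n) w) atTop (𝓝 (inner ℝ y w)) :=
    fun w => (hweak w).comp hmk
  have hzae : ∀ᵐ p, Tendsto (fun n => (z n).fst p) atTop (𝓝 (y.fst p)) := by
    filter_upwards [hae] with p hp using hp.comp hks.tendsto_atTop
  have hy1 := norm_snd_sq_le_of_weak hzw ha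
  have hy2 := graphVolume_le_of_tendsto (fun n => hx _) hzae hm
  have hcoul : Tendsto (fun n => coulomb (B R) (z n).fst (z n).fst) atTop
      (𝓝 (coulomb (B R) y.fst y.fst)) := by
    rw [tendsto_iff_norm_sub_tendsto_zero]
    have h1 : Tendsto (fun n => ‖(z n).fst - y.fst‖) atTop (𝓝 0) :=
      tendsto_iff_norm_sub_tendsto_zero.1 hz
    have h2 := (h1.mul (hz.norm.add_const ‖y.fst‖)).const_mul (coulombConst R).toReal
    rw [zero_mul, mul_zero] at h2
    exact squeeze_zero (fun n => norm_nonneg _) (fun n => abs_coulomb_self_sub_le _ _) h2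
  have hlim : Tendsto (fun n => graphEnergy R q M η (z n)) atTop
      (𝓝 (a + q / 2 * coulomb (B R) y.fst y.fst + M * |‖y.fst‖ ^ 2 - 1| + fEta η m)) :=
    ((ha.add (hcoul.const_mul _)).add ((((hz.norm.pow 2).sub_const 1).abs).const_mul M)).add
      (((continuous_fEta η).tendsto m).comp hm)
  have hinf : Tendsto (fun n => graphEnergy R q M η (z n)) atTop (𝓝 (sInf S)) := by
    refine (hs.comp (hns.tendsto_atTop.comp hmk)).congr fun n => ?_
    exact (hxs _).symm
  refine ⟨y, hy, fun w hw => ?_⟩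
  have hle : graphEnergy R q M η y ≤ sInf S := by
    rw [tendsto_nhds_unique hinf hlim, graphEnergy]
    have := fEta_mono hη hy2
    linarith
  exact hle.trans (csInf_le hSbdd ⟨w, hw, rfl⟩)


/-! ### Smooth cutoffs and truncations -/

/-- A smooth cutoff that vanishes near `0` and equals `1` far from `0`. -/
lemma exists_cutoff : ∃ (h : ℝ → ℝ) (c : ℝ), ContDiff ℝ ∞ h ∧ (∀ s, 0 ≤ h s ∧ h s ≤ 1) ∧
    (∀ s, |s| ≤ 1 / 2 → h s = 0) ∧ (∀ s, 1 ≤ |s| → h s = 1) ∧ (∀ s, |deriv h s| ≤ c) ∧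
    ∀ s, deriv h s ≠ 0 → 0 < |s| ∧ |s| ≤ 1 := by
  let b : ContDiffBump (0 : ℝ) := ⟨1 / 2, 1, by norm_num, by norm_num⟩
  have hb : ContDiff ℝ ∞ b := b.contDiff
  have hd : ∀ s, deriv (fun s => 1 - b s) s = -deriv b s := fun s => by simp
  obtain ⟨c, hc⟩ := (hb.continuous_deriv (by simp)).bounded_above_of_compact_support
    (b.hasCompactSupport.deriv)
  refine ⟨fun s => 1 - b s, c, contDiff_const.sub hb,
    fun s => ⟨sub_nonneg.2 b.le_one, sub_le_self _ b.nonneg⟩, fun s hs => ?_, fun s hs => ?_,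
    fun s => ?_, fun s hs => ?_⟩
  · simp [b.one_of_mem_closedBall (x := s) (by simpa [b] using hs)]
  · simp [b.zero_of_le_dist (x := s) (by simpa [b, Real.dist_eq] using hs)]
  · rw [hd, abs_neg]; exact hc s
  · rw [hd] at hs
    constructor
    · rw [abs_pos]
      rintro rfl
      refine hs ?_
      have : (b : ℝ → ℝ) =ᶠ[𝓝 0] fun _ => 1 := b.eventuallyEq_one
      rw [this.deriv_eq]
      simp
    · by_contra! h1
      refine hs ?_
      have : (b : ℝ → ℝ) =ᶠ[𝓝 s] fun _ => 0 := by
        filter_upwards [continuous_abs.continuousAt.eventually (lt_mem_nhds h1)] with t ht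
        exact b.zero_of_le_dist (by simpa [b, Real.dist_eq] using ht.le)
      rw [this.deriv_eq]
      simp

/-- A smooth substitute for the truncation `s ↦ sign(s) (|s| - 1)₊`: it kills the values in
`[-1, 1]`, is nondecreasing and contracting, and stays at bounded distance from the identity. -/
lemma exists_truncation : ∃ (F : ℝ → ℝ) (A : ℝ), 0 ≤ A ∧ ContDiff ℝ ∞ F ∧
    (∀ s, |s| ≤ 1 → F s = 0) ∧ (∀ s, |deriv F s| ≤ 1) ∧ (∀ s, |s| ≤ 1 → deriv F s = 0) ∧
    ∀ s, |F s - s| ≤ A := by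
  obtain ⟨h, c, hh, h01, h0, h1, -, -⟩ := exists_cutoff
  have hψ : ContDiff ℝ ∞ fun s => h (s / 2) := hh.comp (contDiff_id.div_const 2)
  have hd : ∀ s, HasDerivAt (fun s => ∫ t in (0 : ℝ)..s, h (t / 2)) (h (s / 2)) s := fun s =>
    intervalIntegral.integral_hasDerivAt_right (hψ.continuous.intervalIntegrable _ _)
      (hψ.continuous.stronglyMeasurableAtFilter _ _) hψ.continuous.continuousAt
  have hderiv : deriv (fun s => ∫ t in (0 : ℝ)..s, h (t / 2)) = fun s => h (s / 2) :=
    funext fun s => (hd s).deriv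
  have hzero : ∀ s, |s| ≤ 1 → h (s / 2) = 0 := fun s hs => h0 _ (by
    rw [abs_div, abs_two]; linarith)
  have hsub : Integrable fun t => 1 - h (t / 2) := by
    refine (continuous_const.sub hψ.continuous).integrable_of_hasCompactSupport ?_
    refine HasCompactSupport.of_support_subset_isCompact (isCompact_Icc (a := -2) (b := (2 : ℝ)))
      fun t ht => ?_
    rw [mem_Icc, ← abs_le]
    by_contra! h2
    refine ht ?_
    have : (1 : ℝ) ≤ |t / 2| := by rw [abs_div, abs_two]; linarith
    simp [h1 _ this]
  refine ⟨fun s => ∫ t in (0 : ℝ)..s, h (t / 2), ∫ t, (1 - h (t / 2)),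
    integral_nonneg fun t => sub_nonneg.2 (h01 _).2, ?_, fun s hs => ?_, fun s => ?_,
    fun s hs => ?_, fun s => ?_⟩
  · rw [contDiff_infty_iff_deriv, hderiv]
    exact ⟨fun s => (hd s).differentiableAt, hψ⟩
  · refine (intervalIntegral.integral_congr (g := fun _ => (0 : ℝ)) fun t ht => ?_).trans (by simp)
    refine hzero t ?_
    have := abs_sub_left_of_mem_uIcc ht
    simp only [sub_zero] at this
    exact this.trans hs
  · rw [hderiv, abs_of_nonneg (h01 _).1]; exact (h01 _).2
  · rw [hderiv]; exact hzero s hs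
  · have e : (∫ t in (0 : ℝ)..s, h (t / 2)) - s = -∫ t in (0 : ℝ)..s, (1 - h (t / 2)) := by
      rw [intervalIntegral.integral_sub intervalIntegrable_const
        (hψ.continuous.intervalIntegrable _ _)]
      simp
    rw [e, abs_neg, ← Real.norm_eq_abs]
    refine (intervalIntegral.norm_integral_le_integral_norm_uIoc).trans ?_
    have : ∀ t, ‖1 - h (t / 2)‖ = 1 - h (t / 2) := fun t =>
      Real.norm_of_nonneg (sub_nonneg.2 (h01 _).2)
    simp only [this]
    exact setIntegral_le_integral hsub (Eventually.of_forall fun t => sub_nonneg.2 (h01 _).2)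

/-! ### The perimeter bound -/

/-- The set where `u` is nonzero but at most `ε` in modulus. -/
def lowSet (x : GraphSpace) (ε : ℝ) : Set E3 := {z | 0 < |x.fst z| ∧ |x.fst z| ≤ ε}

lemma measurableSet_lowSet (x : GraphSpace) (ε : ℝ) : MeasurableSet (lowSet x ε) :=
  have hm := (Lp.stronglyMeasurable x.fst).measurable.abs
  (measurableSet_lt measurable_const hm).inter (measurableSet_le hm measurable_const)

lemma integrable_norm_sq {F : Type*} [NormedAddCommGroup F]
    (f : Lp F 2 (volume : Measure E3)) : Integrable fun z => ‖f z‖ ^ 2 :=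
  (memLp_two_iff_integrable_sq_norm (Lp.aestronglyMeasurable f)).1 (Lp.memLp f)

lemma lowSet_subset (x : GraphSpace) (ε : ℝ) : lowSet x ε ⊆ {z | x.fst z ≠ 0} :=
  fun _ hz => abs_pos.1 hz.1

/-- Truncating the values in `[-ε, ε]` removes the gradient energy and the volume of the low set. -/
lemma exists_truncated {R : ℝ} {x : GraphSpace} (hx : x ∈ sobolevGraph (B R))
    {F : ℝ → ℝ} {A : ℝ} (hF : ContDiff ℝ ∞ F) (h0 : ∀ s, |s| ≤ 1 → F s = 0)
    (h1 : ∀ s, |deriv F s| ≤ 1) (h1' : ∀ s, |s| ≤ 1 → deriv F s = 0) (hA0 : 0 ≤ A)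
    (hA : ∀ s, |F s - s| ≤ A) {ε : ℝ} (hε : 0 < ε) :
    ∃ y ∈ sobolevGraph (B R), ‖y.fst‖ ≤ ‖x.fst‖ ∧
      ‖y.fst - x.fst‖ ≤ A * √(volume.real (B R)) * ε ∧
      ‖y.snd‖ ^ 2 + ∫ z in lowSet x ε, ‖x.snd z‖ ^ 2 ≤ ‖x.snd‖ ^ 2 ∧
      graphVolume y + volume.real (lowSet x ε) ≤ graphVolume x := by
  let G : ℝ → ℝ := fun s => ε * F (ε⁻¹ * s)
  have hG : ContDiff ℝ ∞ G := contDiff_const.mul (hF.comp (contDiff_const.mul contDiff_id))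
  have hG0 : G 0 = 0 := by simp [G, h0]
  have hdG : ∀ s, deriv G s = deriv F (ε⁻¹ * s) := by
    intro s
    have := ((((hF.differentiable (by simp)) (ε⁻¹ * s)).hasDerivAt.comp s
      ((hasDerivAt_id s).const_mul ε⁻¹)).const_mul ε).deriv
    rw [show deriv G s = _ from this]
    field_simp
  have hG1 : ∀ s, |deriv G s| ≤ 1 := fun s => by rw [hdG]; exact h1 _
  have hlow : ∀ {s : ℝ}, |s| ≤ ε → |ε⁻¹ * s| ≤ 1 := by
    intro s hs
    rw [abs_mul, abs_of_pos (inv_pos.2 hε), inv_mul_le_iff₀ hε, mul_one]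
    exact hs
  have hGs : ∀ s, |G s - s| ≤ A * ε := by
    intro s
    have e : G s - s = ε * (F (ε⁻¹ * s) - ε⁻¹ * s) := by simp only [G]; field_simp
    rw [e, abs_mul, abs_of_pos hε, mul_comm]
    exact mul_le_mul_of_nonneg_right (hA _) hε.le
  have hoff := ae_eq_zero_off hx
  obtain ⟨y, hy, hy1, hy2⟩ := exists_comp_mem hx hG hG0 hG1
  refine ⟨y, hy, ?_, ?_, ?_, ?_⟩
  · refine Lp.norm_le_norm_of_ae_le ?_
    filter_upwards [hy1] with z hz
    rw [hz]
    simpa [hG0] using norm_sub_le_of_deriv_le hG hG1 (x.fst z) 0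
  · rw [← sq_le_sq₀ (norm_nonneg _) (by positivity), ← integral_norm_sq_eq]
    have e : (A * √(volume.real (B R)) * ε) ^ 2 =
        ∫ z, (B R).indicator (fun _ => (A * ε) ^ 2) z := by
      rw [integral_indicator_const _ Metric.isOpen_ball.measurableSet, smul_eq_mul, mul_pow,
        mul_pow, Real.sq_sqrt measureReal_nonneg]
      ring
    rw [e]
    refine integral_mono_ae (integrable_norm_sq _)
      ((integrable_indicator_iff Metric.isOpen_ball.measurableSet).2
        (integrableOn_const measure_ball_lt_top.ne)) ?_
    filter_upwards [hy1, Lp.coeFn_sub y.fst x.fst, hoff] with z hz hs h0'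
    simp only [hs, Pi.sub_apply, hz]
    by_cases hzR : z ∈ B R
    · rw [indicator_of_mem hzR]
      exact pow_le_pow_left₀ (norm_nonneg _) (hGs _) 2
    · rw [indicator_of_notMem hzR, (h0' hzR).1, hG0]
      simp
  · rw [← integral_norm_sq_eq, ← integral_norm_sq_eq,
      ← integral_indicator (measurableSet_lowSet x ε), ← integral_add (integrable_norm_sq _)
        ((integrable_norm_sq _).indicator (measurableSet_lowSet x ε))]
    refine integral_mono_ae ((integrable_norm_sq _).add
      ((integrable_norm_sq _).indicator (measurableSet_lowSet x ε))) (integrable_norm_sq _) ?_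
    filter_upwards [hy2] with z hz
    simp only [hz]
    by_cases hzl : z ∈ lowSet x ε
    · rw [indicator_of_mem hzl, hdG, h1' _ (hlow hzl.2)]
      simp
    · rw [indicator_of_notMem hzl, add_zero, norm_smul]
      exact pow_le_pow_left₀ (by positivity) (mul_le_of_le_one_left (norm_nonneg _) (hG1 _)) 2
  · have hdisj : Disjoint ({z | x.fst z ≠ 0} \ lowSet x ε) (lowSet x ε) := disjoint_sdiff_left
    have hle : graphVolume y ≤ volume.real ({z | x.fst z ≠ 0} \ lowSet x ε) := by
      refine ENNReal.toReal_mono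
        (measure_ne_top_of_subset sdiff_subset (volume_ne_zero_ne_top hx)) (measure_mono_ae ?_)
      filter_upwards [hy1] with z hz hyz
      have hyz' : G (x.fst z) ≠ 0 := by rw [← hz]; exact hyz
      have hnl : ¬ |x.fst z| ≤ ε := fun hl => hyz' (by simp only [G]; rw [h0 _ (hlow hl), mul_zero])
      exact ⟨fun h0' => hyz' (by rw [h0', hG0]), fun hl => hnl hl.2⟩
    have := measureReal_sdiff_add_inter (μ := volume) (s := {z | x.fst z ≠ 0})
      (measurableSet_lowSet x ε) (volume_ne_zero_ne_top hx)
    rw [inter_eq_self_of_subset_right (lowSet_subset x ε)] at this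
    unfold graphVolume at hle ⊢
    linarith

/-- A bound on the mass of a minimizer that is uniform in `q`, by comparison with `u = 0`. -/
lemma norm_fst_le_two_of_minimal {R q M η : ℝ} (hM : 0 < M) (hq : 0 ≤ q) (hη : η ∈ Ioo (0 : ℝ) 1)
    {x : GraphSpace}
    (hmin : ∀ y ∈ sobolevGraph (B R), graphEnergy R q M η x ≤ graphEnergy R q M η y) :
    ‖x.fst‖ ≤ 2 := by
  have h1 := hmin 0 (sobolevGraph (B R)).zero_mem
  have h2 := le_graphEnergy (R := R) (M := M) hq hη x
  have h0 : graphEnergy R q M η 0 = M - η * volume.real (B 1) := by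
    have hz : ((0 : GraphSpace).fst : E3 → ℝ) =ᵐ[volume] 0 := Lp.coeFn_zero _ _ _
    have hv : graphVolume 0 = 0 := by
      have : volume {z | (0 : GraphSpace).fst z ≠ 0} = 0 := by
        rw [EventuallyEq, ae_iff] at hz
        exact hz
      rw [graphVolume, Measure.real, this, ENNReal.toReal_zero]
    have hc : coulomb (B R) (0 : GraphSpace).fst (0 : GraphSpace).fst = 0 := by
      rw [coulomb_congr_ae _ hz hz]; simp [coulomb]
    rw [graphEnergy, hv, hc, fEta_zero]
    simp
    ring
  have h3 : M * |‖x.fst‖ ^ 2 - 1| ≤ M * 1 := by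
    have := sq_nonneg ‖x.snd‖
    linarith
  have h4 := le_of_mul_le_mul_left h3 hM
  nlinarith [le_abs_self (‖x.fst‖ ^ 2 - 1), norm_nonneg x.fst]

/-- Comparison with the truncation: the low set of a minimizer carries gradient energy and volume
of order `ε`, with a constant independent of `q` and of the minimizer. -/
lemma exists_lowSet_bound {R M η : ℝ} (hM : 0 < M) (hη : η ∈ Ioo (0 : ℝ) 1) :
    ∃ K : ℝ, 0 ≤ K ∧ ∀ q ∈ Ico (0 : ℝ) 1, ∀ x ∈ sobolevGraph (B R),
      (∀ y ∈ sobolevGraph (B R), graphEnergy R q M η x ≤ graphEnergy R q M η y) →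
      ∀ ε > 0, (∫ z in lowSet x ε, ‖x.snd z‖ ^ 2) + η * volume.real (lowSet x ε) ≤ K * ε := by
  obtain ⟨F, A, hA0, hF, h0, h1, h1', hA⟩ := exists_truncation
  refine ⟨((coulombConst R).toReal + M) * (A * √(volume.real (B R)) * 4), by positivity, ?_⟩
  intro q hq x hx hmin ε hε
  obtain ⟨y, hy, hn, hd, hg, hv⟩ := exists_truncated hx hF h0 h1 h1' hA0 hA hε
  have hx2 := norm_fst_le_two_of_minimal hM hq.1 hη hmin
  have hE := hmin y hy
  have hf := mul_sub_le_fEta_sub hη (show graphVolume y ≤ graphVolume x by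
    linarith [measureReal_nonneg (μ := (volume : Measure E3)) (s := lowSet x ε)])
  have hηv : η * volume.real (lowSet x ε) ≤ η * (graphVolume x - graphVolume y) :=
    mul_le_mul_of_nonneg_left (by linarith) hη.1.le
  have hprod : ‖y.fst - x.fst‖ * (‖y.fst‖ + ‖x.fst‖) ≤ A * √(volume.real (B R)) * ε * 4 := by
    gcongr
    linarith
  have hc : q / 2 * coulomb (B R) y.fst y.fst - q / 2 * coulomb (B R) x.fst x.fst ≤
      (coulombConst R).toReal * (A * √(volume.real (B R)) * ε * 4) := by
    have c1 := (abs_coulomb_self_sub_le (R := R) y.fst x.fst).trans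
      (mul_le_mul_of_nonneg_left hprod ENNReal.toReal_nonneg)
    rw [← mul_sub]
    refine (mul_le_mul_of_nonneg_left (le_abs_self _) (by linarith [hq.1])).trans ?_
    refine (mul_le_of_le_one_left (abs_nonneg _) (by linarith [hq.2])).trans c1
  have hm : M * |‖y.fst‖ ^ 2 - 1| - M * |‖x.fst‖ ^ 2 - 1| ≤
      M * (A * √(volume.real (B R)) * ε * 4) := by
    rw [← mul_sub]
    refine mul_le_mul_of_nonneg_left ?_ hM.le
    refine (abs_sub_abs_le_abs_sub _ _).trans (le_trans ?_ hprod)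
    have e : ‖y.fst‖ ^ 2 - 1 - (‖x.fst‖ ^ 2 - 1) = (‖y.fst‖ - ‖x.fst‖) * (‖y.fst‖ + ‖x.fst‖) := by
      ring
    rw [e, abs_mul, abs_of_nonneg (a := ‖y.fst‖ + ‖x.fst‖) (by positivity)]
    exact mul_le_mul_of_nonneg_right (abs_norm_sub_norm_le _ _) (by positivity)
  unfold graphEnergy at hE
  nlinarith

/-- The total variation of the cutoff of a minimizer at height `ε` is bounded by the gradient
energy and the volume of the low set. -/
lemma integral_cutoff_mul_divergence_le {R : ℝ} {x : GraphSpace} (hx : x ∈ sobolevGraph (B R))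
    {h : ℝ → ℝ} {c : ℝ} (hh : ContDiff ℝ ∞ h) (h0 : h 0 = 0) (hc : ∀ s, |deriv h s| ≤ c)
    (hsupp : ∀ s, deriv h s ≠ 0 → 0 < |s| ∧ |s| ≤ 1) {T : E3 → E3} (hT : ContDiff ℝ 1 T)
    (hTc : HasCompactSupport T) (hT1 : ∀ z, ‖T z‖ ≤ 1) {ε : ℝ} (hε : 0 < ε) :
    ∫ z, h (ε⁻¹ * x.fst z) * divergence T z ≤
      c * ε⁻¹ / 2 * ((∫ z in lowSet x ε, ‖x.snd z‖ ^ 2) + volume.real (lowSet x ε)) := by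
  have hc0 : 0 ≤ c := (abs_nonneg _).trans (hc 0)
  let G : ℝ → ℝ := fun s => h (ε⁻¹ * s)
  have hG : ContDiff ℝ ∞ G := hh.comp (contDiff_const.mul contDiff_id)
  have hdG : ∀ s, deriv G s = deriv h (ε⁻¹ * s) * ε⁻¹ := by
    intro s
    have := (((hh.differentiable (by simp)) (ε⁻¹ * s)).hasDerivAt.comp s
      ((hasDerivAt_id s).const_mul ε⁻¹)).deriv
    rw [show deriv G s = _ from this]
    simp
  have hε' : 0 < ε⁻¹ := inv_pos.2 hε
  have hGc : ∀ s, |deriv G s| ≤ c * ε⁻¹ := fun s => by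
    rw [hdG, abs_mul, abs_of_pos hε']
    exact mul_le_mul_of_nonneg_right (hc _) hε'.le
  have hGlow : ∀ s, deriv G s ≠ 0 → 0 < |s| ∧ |s| ≤ ε := by
    intro s hs
    rw [hdG] at hs
    obtain ⟨a, b⟩ := hsupp _ (left_ne_zero_of_mul hs)
    rw [abs_mul, abs_of_pos hε'] at a b
    exact ⟨pos_of_mul_pos_right a hε'.le, by rwa [inv_mul_le_iff₀ hε, mul_one] at b⟩
  obtain ⟨y, hy, hy1, hy2⟩ := exists_comp_mem hx hG (by simp [G, h0]) hGc
  have hm := measurableSet_lowSet x ε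
  have hvol : volume (lowSet x ε) ≠ ⊤ :=
    measure_ne_top_of_subset (lowSet_subset x ε) (volume_ne_zero_ne_top hx)
  have e1 : ∫ z, h (ε⁻¹ * x.fst z) * divergence T z = -∫ z, inner ℝ (y.snd z) (T z) := by
    rw [← integral_fst_mul_divergence hy hT hTc]
    refine integral_congr_ae ?_
    filter_upwards [hy1] with z hz
    rw [hz]
  have hi : IntegrableOn (fun z => c * ε⁻¹ / 2 * (‖x.snd z‖ ^ 2 + 1)) (lowSet x ε) :=
    ((integrable_norm_sq _).integrableOn.add (integrableOn_const hvol)).const_mul _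
  have hT2 : MemLp T 2 (volume : Measure E3) := hT.continuous.memLp_of_hasCompactSupport hTc
  have hint : Integrable fun z => inner ℝ (y.snd z) (T z) := by
    refine (L2.integrable_inner (𝕜 := ℝ) y.snd (hT2.toLp T)).congr ?_
    filter_upwards [hT2.coeFn_toLp] with z hz
    rw [hz]
  rw [e1, ← integral_neg]
  calc ∫ z, -inner ℝ (y.snd z) (T z)
      ≤ ∫ z, (lowSet x ε).indicator (fun z => c * ε⁻¹ / 2 * (‖x.snd z‖ ^ 2 + 1)) z := by
        refine integral_mono_ae hint.neg ((integrable_indicator_iff hm).2 hi) ?_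
        filter_upwards [hy2] with z hz
        by_cases hzl : z ∈ lowSet x ε
        · rw [indicator_of_mem hzl]
          calc -inner ℝ (y.snd z) (T z) ≤ ‖y.snd z‖ * ‖T z‖ :=
                (neg_le_abs _).trans (abs_real_inner_le_norm _ _)
            _ ≤ ‖y.snd z‖ := mul_le_of_le_one_right (norm_nonneg _) (hT1 z)
            _ ≤ c * ε⁻¹ * ‖x.snd z‖ := by
                rw [hz, norm_smul]
                exact mul_le_mul_of_nonneg_right (hGc _) (norm_nonneg _)
            _ ≤ c * ε⁻¹ * ((‖x.snd z‖ ^ 2 + 1) / 2) := by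
                refine mul_le_mul_of_nonneg_left ?_ (by positivity)
                nlinarith [sq_nonneg (‖x.snd z‖ - 1)]
            _ = _ := by ring
        · have hz0 : deriv G (x.fst z) = 0 := by
            by_contra hne
            exact hzl (hGlow _ hne)
          rw [indicator_of_notMem hzl, hz, hz0]
          simp
    _ = _ := by
        rw [integral_indicator hm, integral_const_mul,
          integral_add (integrable_norm_sq _).integrableOn (integrableOn_const hvol)]
        simp

/-- The perimeter of the support of a minimizer is bounded uniformly in `q`. -/
theorem exists_perimeter_bound {R M η : ℝ} (hM : 0 < M) (hη : η ∈ Ioo (0 : ℝ) 1) :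
    ∃ C : ℝ, ∀ q ∈ Ico (0 : ℝ) 1, ∀ x ∈ sobolevGraph (B R),
      (∀ y ∈ sobolevGraph (B R), graphEnergy R q M η x ≤ graphEnergy R q M η y) →
      ∀ T : E3 → E3, ContDiff ℝ 1 T → HasCompactSupport T → (∀ z, ‖T z‖ ≤ 1) →
        ∫ z in {z | x.fst z ≠ 0}, divergence T z ≤ C := by
  obtain ⟨K, hK0, hK⟩ := exists_lowSet_bound (R := R) hM hη
  obtain ⟨h, c, hh, h01, h0, h1, hc, hsupp⟩ := exists_cutoff
  have hc0 : 0 ≤ c := (abs_nonneg _).trans (hc 0)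
  refine ⟨c / 2 * (K + K / η), ?_⟩
  intro q hq x hx hmin T hT hTc hT1
  have hdi : Integrable (divergence T) :=
    (continuous_divergence hT).integrable_of_hasCompactSupport (hasCompactSupport_divergence hTc)
  let ε : ℕ → ℝ := fun n => 1 / ((n : ℝ) + 1)
  have hε : ∀ n, 0 < ε n := fun n => Nat.one_div_pos_of_nat
  have hbound : ∀ n, ∫ z, h ((ε n)⁻¹ * x.fst z) * divergence T z ≤ c / 2 * (K + K / η) := by
    intro n
    have hl := hK q hq x hx hmin (ε n) (hε n)
    have hi0 : 0 ≤ ∫ z in lowSet x (ε n), ‖x.snd z‖ ^ 2 := integral_nonneg fun z => by positivity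
    have hv0 : 0 ≤ volume.real (lowSet x (ε n)) := measureReal_nonneg
    have hi : ∫ z in lowSet x (ε n), ‖x.snd z‖ ^ 2 ≤ K * ε n := by
      linarith [mul_nonneg hη.1.le hv0]
    have hv : volume.real (lowSet x (ε n)) ≤ K * ε n / η := by
      rw [le_div_iff₀ hη.1, mul_comm]; linarith
    have hεn := hε n
    have hη0 := hη.1
    calc _ ≤ _ := integral_cutoff_mul_divergence_le hx hh (h0 0 (by simp)) hc hsupp hT hTc hT1 hεn
      _ ≤ c * (ε n)⁻¹ / 2 * (K * ε n + K * ε n / η) := by gcongr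
      _ = _ := by field_simp
  have hlim : Tendsto (fun n => ∫ z, h ((ε n)⁻¹ * x.fst z) * divergence T z) atTop
      (𝓝 (∫ z, {z | x.fst z ≠ 0}.indicator (divergence T) z)) := by
    refine tendsto_integral_of_dominated_convergence (fun z => ‖divergence T z‖) (fun n => ?_)
      hdi.norm (fun n => Eventually.of_forall fun z => ?_) (Eventually.of_forall fun z => ?_)
    · exact (hh.continuous.comp_aestronglyMeasurable
        ((Lp.aestronglyMeasurable _).const_mul _)).mul hdi.1
    · rw [norm_mul, Real.norm_of_nonneg (h01 _).1]
      exact mul_le_of_le_one_left (norm_nonneg _) (h01 _).2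
    · by_cases hz : x.fst z = 0
      · simp [hz, h0 0]
      · refine tendsto_const_nhds.congr' ?_
        have := (tendsto_one_div_add_atTop_nhds_zero_nat (𝕜 := ℝ)).eventually
          (gt_mem_nhds (abs_pos.2 hz))
        filter_upwards [this] with n hn
        have h2 : 1 ≤ |(ε n)⁻¹ * x.fst z| := by
          rw [abs_mul, abs_of_pos (inv_pos.2 (hε n)), le_inv_mul_iff₀ (hε n), mul_one]
          exact hn.le
        rw [h1 _ h2, one_mul, indicator_of_mem (by exact hz)]
  rw [← integral_indicator (measurableSet_ne_zero x)]
  exact le_of_tendsto hlim (Eventually.of_forall hbound)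

end
end CoulombDrop

theorem theorem4p3 (R : ℝ) (hR : 0 < R) (M : ℝ) (hM : 0 < M)
    (η : ℝ) (hη : η ∈ Set.Ioo (0 : ℝ) 1) :
    (∀ q ∈ Set.Ico (0 : ℝ) 1, ∃ u : CoulombDrop.E3 → ℝ, CoulombDrop.IsMinimizer R q M η u) ∧
    ∃ C : ℝ, ∀ q ∈ Set.Ico (0 : ℝ) 1, ∀ u : CoulombDrop.E3 → ℝ,
      CoulombDrop.IsMinimizer R q M η u →
        CoulombDrop.perimeter {x | u x ≠ 0} ≤ ENNReal.ofReal C := by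
  constructor
  · intro q hq
    obtain ⟨y, hy, hmin⟩ := CoulombDrop.exists_graphEnergy_min (R := R) hM hq.1 hη
    exact ⟨y.fst, (CoulombDrop.isMinimizer_iff hy (ae_eq_refl _)).2 hmin⟩
  · obtain ⟨C, hC⟩ := CoulombDrop.exists_perimeter_bound (R := R) hM hη
    refine ⟨C, fun q hq u hu => ?_⟩
    obtain ⟨x, hx, hux⟩ := CoulombDrop.mem_H10_iff.1 hu.1
    refine iSup₂_le fun T hT => ENNReal.ofReal_le_ofReal ?_
    have hset : ({z | u z ≠ 0} : Set CoulombDrop.E3) =ᵐ[volume] {z | x.fst z ≠ 0} := by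
      filter_upwards [hux] with z hz
      exact congrArg (· ≠ 0) hz
    rw [setIntegral_congr_set hset]
    exact hC q hq x hx ((CoulombDrop.isMinimizer_iff hx hux).1 hu) T hT.1 hT.2.1 hT.2.2
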